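/- Let $L\subset\mathbb R^2$ be a lattice and let $\mathcal D$ be a hyperbolic automorphism of the torus $\mathbb T^2=\mathbb R^2/L$, in coordinates in which the stable direction is horizontal and the unstable direction is vertical: $\mathcal D$ is induced by $\mathrm{diag}(\mu,\lambda)$ with $|\lambda|>1$, $|\mu|=1/|\lambda|$, which maps $L$ onto itself. A bi-partition of $\mathbb T^2$ is, up to translation, the pair $R_1=[0,u]\times[0,p]$, $R_2=[-v,0]\times[0,q]$ with $u,v,p,q>0$ such that $[v,p]$ and $[-u,q]$ generate $L$; its horizontal spine $J^s$ and vertical spine $J^u$ are the unions, in $\mathbb T^2$, of the horizontal, respectively vertical, sides of $R_1,R_2$. It is a Berg partition of $\mathcal D$ if $\mathcal D(J^s)\subset J^s$ and $\mathcal D(J^u)\supset J^u$. For either ordering of the two rectangles, the entry $c_{ij}$ of its connectivity matrix is the number of translates of $R_j$ by vectors of $L$ whose interior meets the interior of the image of $R_i$ under $\mathrm{diag}(\mu,\lambda)$. Two bi-partitions are equivalent if some homeomorphism of $\mathbb T^2$ commuting with $\mathcal D$ takes one into the other, without regard to the ordering of the rectangles. (1) If $\{R_1,R_2\}$ and $\{R_1',R_2'\}$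 are two Berg partitions of $\mathcal D$ with the same connectivity matrix (for some orderings of the rectangles), then there is a translation $\mathcal T$ of $\mathbb T^2$ such that $\{\mathcal T(R_1),\mathcal T(R_2)\}$ is a Berg partition equivalent to $\{R'_1,R'_2\}$. (2) Let $\mathcal F$ be the set of bases $\{e,f\}$ of $L$ with $e$ in the open first and $f$ in the open second quadrant. Then $\mathcal F$ is non-empty. Given $\{e_0,f_0\}\in\mathcal F$, let $\{e_n,f_n\}_{n\in\mathbb Z}$ be the sequence of bases obtained from it by the cutting algorithm: $(e_{n+1},f_{n+1})=(e_n+f_n,f_n)$ and $s_n=1$ if $e_n+f_n$ is in the right half-plane, and $(e_{n+1},f_{n+1})=(e_n,e_n+f_n)$ and $s_n=0$ otherwise, and backwards, $(e_{n-1},f_{n-1})=(e_n-f_n,f_n)$ if $e_n-f_n$ is in the upper half-plane and $(e_n,f_n-e_n)$ otherwise. Then the cutting sequence $(s_n)_{n\in\mathbb Z}$ has a basic (semi-)period $N$: the smallest $N\ge1$ with $s_{k+N}=1-s_k$ for all $k$ or, if there is none, the smallest $N\ge1$ with $s_{k+N}=s_k$ for all $k$. There are exactly $N$ shapes of Berg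 partitions of $\mathcal D$, where two Berg partitions have the same shape if a translate of the first is equivalent to the second: there are $N$ Berg partitions such that every Berg partition of $\mathcal D$ has the same shape as exactly one of them. -/

import Mathlib

open Set

noncomputable section

/-- The plane, with its horizontal (first) and vertical (second) coordinate. -/
abbrev Plane : Type := ℝ × ℝ

/-- A hyperbolic toral automorphism of `ℝ² / L`, in the coordinates in which the stable direction
is the horizontal axis and the unstable direction is the vertical axis: it is induced by
`diag(μ, λ)` with `|λ| > 1` and `|μ| = 1 / |λ|`, which maps the lattice `L` onto itself. -/
structure HyperbolicToralAut (L : Submodule ℤ Plane) where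
  mu : ℝ
  lam : ℝ
  one_lt_abs_lam : 1 < |lam|
  abs_mu : |mu| = 1 / |lam|
  map_mem_iff : ∀ z : Plane, (mu * z.1, lam * z.2) ∈ L ↔ z ∈ L

namespace HyperbolicToralAut

variable {L : Submodule ℤ Plane}

/-- The linear map `diag(μ, λ)` of the plane. -/
def planeMap (D : HyperbolicToralAut L) : Plane →ₗ[ℤ] Plane where
  toFun z := (D.mu * z.1, D.lam * z.2)
  map_add' z w := by ext <;> simp [mul_add]
  map_smul' a z := by ext <;> simp [mul_left_comm]

/-- The induced map of the torus `ℝ² / L`. -/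
def torusMap (D : HyperbolicToralAut L) : (Plane ⧸ L) →ₗ[ℤ] (Plane ⧸ L) :=
  L.mapQ L D.planeMap (fun z hz => (D.map_mem_iff z).2 hz)

end HyperbolicToralAut

/-- A bi-partition of the torus `ℝ² / L`: two adjacent rectangles with bases on a common
horizontal line and a common corner `w`, the `u × p` rectangle `R₁` lying to the right and the
`v × q` rectangle `R₂` to the left of the vertical line through `w`, where `[v, p]`, `[-u, q]`
generate the lattice `L`. -/
structure BiPartition (L : Submodule ℤ Plane) where
  u : ℝ
  v : ℝ
  p : ℝ
  q : ℝ
  w : Plane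
  u_pos : 0 < u
  v_pos : 0 < v
  p_pos : 0 < p
  q_pos : 0 < q
  span_eq : Submodule.span ℤ {((v, p) : Plane), ((-u, q) : Plane)} = L

namespace BiPartition

variable {L : Submodule ℤ Plane}

/-- Abscissa of the left side of each of the two rectangles. -/
def left (P : BiPartition L) : Fin 2 → ℝ := ![P.w.1, P.w.1 - P.v]

/-- Abscissa of the right side. -/
def right (P : BiPartition L) : Fin 2 → ℝ := ![P.w.1 + P.u, P.w.1]

/-- Ordinate of the bottom side. -/
def bottom (P : BiPartition L) : Fin 2 → ℝ := ![P.w.2, P.w.2]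

/-- Ordinate of the top side. -/
def top (P : BiPartition L) : Fin 2 → ℝ := ![P.w.2 + P.p, P.w.2 + P.q]

/-- The two (closed) rectangles in the plane. -/
def rect (P : BiPartition L) (i : Fin 2) : Set Plane :=
  Icc (P.left i) (P.right i) ×ˢ Icc (P.bottom i) (P.top i)

/-- The open rectangles, projected to the torus. The elements of the partition are recorded by
their open rectangles (whose closures are the projections of the closed rectangles), because the
projection of a closed connected rectangle touches itself along a part of its boundary. -/
def tile (P : BiPartition L) (i : Fin 2) : Set (Plane ⧸ L) :=
  L.mkQ '' interior (P.rect i)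

/-- The horizontal spine `Jˢ`: the union of the horizontal sides, in the torus. -/
def horizontalSpine (P : BiPartition L) : Set (Plane ⧸ L) :=
  L.mkQ '' ⋃ i : Fin 2, Icc (P.left i) (P.right i) ×ˢ {P.bottom i, P.top i}

/-- The vertical spine `Jᵘ`: the union of the vertical sides, in the torus. -/
def verticalSpine (P : BiPartition L) : Set (Plane ⧸ L) :=
  L.mkQ '' ⋃ i : Fin 2, {P.left i, P.right i} ×ˢ Icc (P.bottom i) (P.top i)

/-- The image of a bi-partition under the translation of the torus induced by `t`. -/
def translate (P : BiPartition L) (t : Plane) : BiPartition L where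
  u := P.u
  v := P.v
  p := P.p
  q := P.q
  w := P.w + t
  u_pos := P.u_pos
  v_pos := P.v_pos
  p_pos := P.p_pos
  q_pos := P.q_pos
  span_eq := P.span_eq

end BiPartition

namespace HyperbolicToralAut

variable {L : Submodule ℤ Plane}

/-- Berg partitions of `D`. -/
def IsBerg (D : HyperbolicToralAut L) (P : BiPartition L) : Prop :=
  D.torusMap '' P.horizontalSpine ⊆ P.horizontalSpine ∧
    P.verticalSpine ⊆ D.torusMap '' P.verticalSpine

/-- The connectivity matrix, for the ordering `R (σ 0), R (σ 1)` of the two rectangles: the entry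
`(i, j)` is the number of translates of the `j`-th rectangle, by vectors of `L`, whose interior is
intersected by the interior of the image of the `i`-th rectangle. -/
def connectivityMatrix (D : HyperbolicToralAut L) (P : BiPartition L)
    (σ : Equiv.Perm (Fin 2)) : Matrix (Fin 2) (Fin 2) ℕ :=
  Matrix.of fun i j => Set.ncard
    {l : Plane | l ∈ L ∧
      ((D.planeMap '' interior (P.rect (σ i))) ∩
        ((fun z => z + l) '' interior (P.rect (σ j)))).Nonempty}

/-- Two bi-partitions have the same connectivity matrix, for some orderings of their rectangles. -/
def SameConnectivity (D : HyperbolicToralAut L) (P Q : BiPartition L) : Prop :=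
  ∃ σ τ : Equiv.Perm (Fin 2), D.connectivityMatrix P σ = D.connectivityMatrix Q τ

/-- Equivalence of partitions: some homeomorphism of the torus that commutes with `D` takes the
one into the other, without regard to the ordering of the rectangles. -/
def Equivalent (D : HyperbolicToralAut L) (P Q : BiPartition L) : Prop :=
  ∃ h : (Plane ⧸ L) ≃ₜ (Plane ⧸ L), (∀ x, h (D.torusMap x) = D.torusMap (h x)) ∧
    ∃ σ : Equiv.Perm (Fin 2), ∀ i, h '' P.tile i = Q.tile (σ i)

/-- Two partitions have the same shape: a translate of the first is equivalent to the second. -/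
def SameShape (D : HyperbolicToralAut L) (P Q : BiPartition L) : Prop :=
  ∃ t : Plane, D.Equivalent (P.translate t) Q

end HyperbolicToralAut

/-- The bi-fan of `L`: bases `(e, f)` of `L` with `e` in the open first and `f` in the open second
quadrant. -/
def biFan (L : Submodule ℤ Plane) : Set (Plane × Plane) :=
  {b | 0 < b.1.1 ∧ 0 < b.1.2 ∧ b.2.1 < 0 ∧ 0 < b.2.2 ∧ Submodule.span ℤ {b.1, b.2} = L}

/-- One step of the cutting algorithm: `(e, f)` becomes `(e + f, f)` if `e + f` is in the right
half-plane and `(e, e + f)` otherwise. -/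
def cutForward (b : Plane × Plane) : Plane × Plane :=
  open Classical in
  if 0 < (b.1 + b.2).1 then (b.1 + b.2, b.2) else (b.1, b.1 + b.2)

/-- One step of the algorithm backwards: `(e, f)` becomes `(e - f, f)` if `e - f` is in the upper
half-plane and `(e, f - e)` otherwise. -/
def cutBackward (b : Plane × Plane) : Plane × Plane :=
  open Classical in
  if 0 < (b.1 - b.2).2 then (b.1 - b.2, b.2) else (b.1, b.2 - b.1)

/-- The bi-infinite sequence of bases `(eₙ, fₙ)` that the cutting algorithm produces from
`(e₀, f₀) = b`. -/
def cutBasis (b : Plane × Plane) : ℤ → Plane × Plane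
  | Int.ofNat n => cutForward^[n] b
  | Int.negSucc n => cutBackward^[n + 1] b

/-- The cutting sequence: `sₙ = 1` if `fₙ₊₁ = fₙ`, and `sₙ = 0` otherwise, i.e. if
`eₙ₊₁ = eₙ`. -/
def cuttingSeq (b : Plane × Plane) (n : ℤ) : ℤ :=
  open Classical in
  if (cutBasis b (n + 1)).2 = (cutBasis b n).2 then 1 else 0

/-- `N` is a period of `s`. -/
def IsPeriod (s : ℤ → ℤ) (N : ℕ) : Prop := 0 < N ∧ ∀ k : ℤ, s (k + N) = s k

/-- `N` is a semi-period of the 0-1 sequence `s`. -/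
def IsSemiPeriod (s : ℤ → ℤ) (N : ℕ) : Prop := 0 < N ∧ ∀ k : ℤ, s (k + N) = 1 - s k

/-- `N` is the basic (semi-)period of `s`: its smallest semi-period or, if there is no semi-period,
its smallest period. -/
def IsBasicSemiPeriodOrPeriod (s : ℤ → ℤ) (N : ℕ) : Prop :=
  IsLeast {M | IsSemiPeriod s M} N ∨
    ((¬ ∃ M, IsSemiPeriod s M) ∧ IsLeast {M | IsPeriod s M} N)

end

/-!
Up to translation a bi-partition is the same thing as a basis `(e, f)` of `L` with `e` in the open
first and `f` in the open second quadrant, and the cutting algorithm, run forwards and backwards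
from any one of these bases, reaches all of them.

A homeomorphism of the torus that commutes with the hyperbolic map lifts to an affine map with
diagonal linear part: both coordinates of the lift, minus suitable linear functions, are periodic
and multiplied by a factor of modulus different from `1`, hence constant. So two bi-partitions have
the same shape if and only if a diagonal matrix takes the basis of the first to that of the second,
up to signs and order. This happens if and only if one cutting sequence is equal to the other or (if
the matrix exchanges the two quadrants) to its complement. Shapes therefore correspond to `ℤ`
modulo the shifts that take the cutting sequence to itself or to its complement, and the square of
the automorphism shows that this quotient is finite.

The spines are the images of one horizontal and one vertical segment. After a suitable translation
the first is mapped into itself and the second over itself, so that every shape is the shape of a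
Berg partition.

The image of a rectangle of a Berg partition crosses every rectangle that it meets from bottom to
top. Hence the heights of the rectangles are an eigenvector of the connectivity matrix for the
eigenvalue `|λ|`, which is not an integer, so that the matrix determines the heights up to a factor;
the heights determine the widths up to a factor because `diag(μ, λ)` preserves `L`.
-/

noncomputable section

/-! ### Lattices -/

section Span

variable {R M : Type*} [Ring R] [AddCommGroup M] [Module R M]

lemma span_pair_le_iff {x y : M} {N : Submodule R M} :
    Submodule.span R {x, y} ≤ N ↔ x ∈ N ∧ y ∈ N := by
  rw [Submodule.span_le, insert_subset_iff, singleton_subset_iff, SetLike.mem_coe, SetLike.mem_coe]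

lemma mem_and_mem_of_span_pair_eq {x y : M} {N : Submodule R M}
    (h : Submodule.span R {x, y} = N) : x ∈ N ∧ y ∈ N :=
  span_pair_le_iff.1 h.le

lemma span_pair_sub_left (x y : M) : Submodule.span R {x - y, y} = Submodule.span R {x, y} := by
  refine le_antisymm (span_pair_le_iff.2 ⟨?_, ?_⟩) (span_pair_le_iff.2 ⟨?_, ?_⟩) <;>
    rw [Submodule.mem_span_pair]
  exacts [⟨1, -1, by simp [sub_eq_add_neg]⟩, ⟨0, 1, by simp⟩, ⟨1, 1, by simp⟩, ⟨0, 1, by simp⟩]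

lemma span_pair_sub_right (x y : M) : Submodule.span R {x, y - x} = Submodule.span R {x, y} := by
  rw [pair_comm, span_pair_sub_left, pair_comm]

lemma span_pair_eq_of_basis {N : Submodule R M} (B : Module.Basis (Fin 2) R N) :
    Submodule.span R {(B 0 : M), (B 1 : M)} = N := by
  have h := congrArg (Submodule.map N.subtype) B.span_eq
  rw [Submodule.map_span, Submodule.map_top, Submodule.range_subtype, ← range_comp] at h
  convert h using 2
  ext x
  simp [Fin.exists_fin_two, eq_comm]

end Span

section DiscreteSubgroup

variable {E : Type*} [NormedAddCommGroup E] (L : Submodule ℤ E) [DiscreteTopology L]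

lemma exists_pos_forall_le_norm : ∃ ε > 0, ∀ l ∈ L, l ≠ 0 → ε ≤ ‖l‖ := by
  obtain ⟨ε, hε, hball⟩ :=
    Metric.exists_ball_inter_eq_singleton_of_mem_discrete (s := (L : Set E)) ⟨‹_›⟩ L.zero_mem
  refine ⟨ε, hε, fun l hl hl0 => not_lt.1 fun hlt => hl0 ?_⟩
  exact mem_singleton_iff.1 (hball ▸ ⟨mem_ball_zero_iff.2 hlt, hl⟩)

variable {L}

lemma eq_zero_of_forall_pow_smul_mem [NormedSpace ℝ E] {c : ℝ} (hc0 : c ≠ 0) (hc1 : |c| < 1)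
    {l : E} (hl : ∀ n : ℕ, c ^ n • l ∈ L) : l = 0 := by
  obtain ⟨ε, hε, hL⟩ := exists_pos_forall_le_norm L
  have hlim : Filter.Tendsto (fun n : ℕ => ‖c ^ n • l‖) Filter.atTop (nhds 0) := by
    simpa using ((tendsto_pow_atTop_nhds_zero_of_abs_lt_one hc1).smul_const l).norm
  obtain ⟨n, hn⟩ := (hlim.eventually (gt_mem_nhds hε)).exists
  by_contra hl0
  exact hn.not_ge (hL _ (hl n) (smul_ne_zero (pow_ne_zero n hc0) hl0))

variable [NormedSpace ℝ E] [FiniteDimensional ℝ E] [IsZLattice ℝ L]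

lemma exists_forall_abs_le_of_periodic {g : E → ℝ} (hg : Continuous g)
    (hper : ∀ l ∈ L, ∀ z, g (z + l) = g z) : ∃ z₀, ∀ z, |g z| ≤ |g z₀| := by
  have := ZLattice.module_free ℝ L
  have := ZLattice.module_finite ℝ L
  have B := Module.Free.chooseBasis ℤ L
  set b := B.ofZLatticeBasis ℝ L
  have hK : IsCompact (closure (ZSpan.fundamentalDomain b)) :=
    (ZSpan.fundamentalDomain_isBounded b).isCompact_closure
  obtain ⟨z₀, -, hz₀⟩ := hK.exists_isMaxOn (f := fun z => |g z|)
    ⟨_, subset_closure (ZSpan.fract_mem_fundamentalDomain b 0)⟩ (by fun_prop)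
  refine ⟨z₀, fun z => ?_⟩
  have hfloor : (ZSpan.floor b z : E) ∈ L :=
    (B.ofZLatticeBasis_span ℝ L).le (ZSpan.floor b z).2
  have hz : g z = g (ZSpan.fract b z) := by
    rw [← hper _ hfloor (ZSpan.fract b z), ZSpan.fract_apply, sub_add_cancel]
  rw [hz]
  exact hz₀ (subset_closure (ZSpan.fract_mem_fundamentalDomain b z))

end DiscreteSubgroup

/-- No nonzero vector of `L` lies on a coordinate axis. This is all that the combinatorics of the
bases of `L` needs to know about the hyperbolic automorphism. -/
structure AxisFree (L : Submodule ℤ Plane) : Prop where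
  eq_zero_of_fst : ∀ l ∈ L, l.1 = 0 → l = 0
  eq_zero_of_snd : ∀ l ∈ L, l.2 = 0 → l = 0

lemma mem_span_pair_iff_coord {a b z : Plane} : z ∈ Submodule.span ℤ {a, b} ↔
    ∃ m n : ℤ, z.1 = m * a.1 + n * b.1 ∧ z.2 = m * a.2 + n * b.2 := by
  simp only [Submodule.mem_span_pair, Prod.ext_iff, Prod.fst_add, Prod.snd_add, Prod.smul_fst,
    Prod.smul_snd, ← Int.cast_smul_eq_zsmul ℝ, smul_eq_mul, eq_comm]

namespace HyperbolicToralAut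

variable {L : Submodule ℤ Plane} (D : HyperbolicToralAut L)

lemma lam_ne_zero : D.lam ≠ 0 :=
  abs_pos.1 (zero_lt_one.trans D.one_lt_abs_lam)

lemma abs_mu_pos : 0 < |D.mu| := by
  rw [D.abs_mu]
  exact one_div_pos.2 (abs_pos.2 D.lam_ne_zero)

lemma mu_ne_zero : D.mu ≠ 0 :=
  abs_pos.1 D.abs_mu_pos

lemma abs_mu_mul_abs_lam : |D.mu| * |D.lam| = 1 := by
  rw [D.abs_mu, one_div_mul_cancel (abs_ne_zero.2 D.lam_ne_zero)]

lemma abs_mu_lt_one : |D.mu| < 1 := by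
  rw [D.abs_mu, one_div]
  exact inv_lt_one_of_one_lt₀ D.one_lt_abs_lam

lemma mu_ne_lam : D.mu ≠ D.lam :=
  fun h => (D.abs_mu_lt_one.trans D.one_lt_abs_lam).ne (congrArg abs h)

lemma planeMap_apply (z : Plane) : D.planeMap z = (D.mu * z.1, D.lam * z.2) := rfl

lemma planeMap_ne_zsmul {a : Plane} (h1 : a.1 ≠ 0) (h2 : a.2 ≠ 0) (m : ℤ) :
    D.planeMap a ≠ m • a := by
  intro h
  simp only [planeMap_apply, ← Int.cast_smul_eq_zsmul ℝ, Prod.ext_iff, Prod.smul_fst,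
    Prod.smul_snd, smul_eq_mul] at h
  exact D.mu_ne_lam ((mul_right_cancel₀ h1 h.1).trans (mul_right_cancel₀ h2 h.2).symm)

lemma planeMap_mem_iff {z : Plane} : D.planeMap z ∈ L ↔ z ∈ L :=
  D.map_mem_iff z

lemma continuous_planeMap : Continuous D.planeMap := by
  change Continuous fun z : Plane => (D.mu * z.1, D.lam * z.2)
  fun_prop

lemma planeMap_surjective : Function.Surjective D.planeMap := fun z =>
  ⟨(z.1 / D.mu, z.2 / D.lam), by
    rw [planeMap_apply, mul_div_cancel₀ _ D.mu_ne_zero, mul_div_cancel₀ _ D.lam_ne_zero]⟩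

lemma torusMap_mkQ (z : Plane) : D.torusMap (L.mkQ z) = L.mkQ (D.planeMap z) := rfl

end HyperbolicToralAut

section AxisFree

variable {L : Submodule ℤ Plane}

theorem HyperbolicToralAut.axisFree [DiscreteTopology L] (D : HyperbolicToralAut L) :
    AxisFree L where
  eq_zero_of_fst := by
    rintro ⟨x, y⟩ hl (rfl : x = 0)
    refine eq_zero_of_forall_pow_smul_mem (L := L) (inv_ne_zero D.lam_ne_zero)
      (by rw [abs_inv]; exact inv_lt_one_of_one_lt₀ D.one_lt_abs_lam) fun n => ?_
    induction n with
    | zero => simpa using hl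
    | succ n ih =>
      rw [← D.planeMap_mem_iff]
      convert ih using 1
      ext <;> simp [D.planeMap_apply, pow_succ', mul_assoc, D.lam_ne_zero]
  eq_zero_of_snd := by
    rintro ⟨x, y⟩ hl (rfl : y = 0)
    refine eq_zero_of_forall_pow_smul_mem (L := L) D.mu_ne_zero D.abs_mu_lt_one fun n => ?_
    induction n with
    | zero => simpa using hl
    | succ n ih =>
      rw [← D.planeMap_mem_iff] at ih
      convert ih using 1
      ext <;> simp [D.planeMap_apply, pow_succ', mul_assoc]

lemma HyperbolicToralAut.span_singleton_ne (D : HyperbolicToralAut L) (hL : AxisFree L)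
    {a : Plane} (ha : a ≠ 0) : Submodule.span ℤ {a} ≠ L := by
  intro h
  have haL : a ∈ L := h ▸ Submodule.mem_span_singleton_self a
  obtain ⟨m, hm⟩ := Submodule.mem_span_singleton.1 (h.ge (D.planeMap_mem_iff.2 haL))
  exact D.planeMap_ne_zsmul (mt (hL.eq_zero_of_fst a haL) ha) (mt (hL.eq_zero_of_snd a haL) ha) m
    hm.symm

end AxisFree

/-! ### The bi-fan is non-empty -/

section BiFan

variable {L : Submodule ℤ Plane}

lemma biFan_nonempty_of_fst_mul_neg {a c : Plane} (hac : a.1 * c.1 < 0) (ha : 0 < a.2)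
    (hc : 0 < c.2) (hspan : Submodule.span ℤ {a, c} = L) : (biFan L).Nonempty := by
  rcases mul_neg_iff.1 hac with ⟨h1, h2⟩ | ⟨h1, h2⟩
  · exact ⟨(a, c), h1, ha, h2, hc, hspan⟩
  · exact ⟨(c, a), h2, hc, h1, ha, by rwa [pair_comm]⟩

lemma abs_sub_eq_of_mul_pos {x y : ℝ} (h : 0 < (x - y) * y) : |x - y| = |x| - |y| := by
  rcases mul_pos_iff.1 h with ⟨h1, h2⟩ | ⟨h1, h2⟩
  · rw [abs_of_pos h1, abs_of_pos h2, abs_of_pos (by linarith)]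
  · rw [abs_of_neg h1, abs_of_neg h2, abs_of_neg (by linarith)]
    ring

-- The Euclidean algorithm: as long as both vectors lie in the same quadrant, subtracting the lower
-- one from the higher one shrinks the coordinates by at least `ε`.
lemma biFan_nonempty_of_pos_snd (D : HyperbolicToralAut L) (hL : AxisFree L) {ε : ℝ}
    (hε : ∀ l ∈ L, l ≠ 0 → ε ≤ |l.1| + |l.2|) (n : ℕ) :
    ∀ a c : Plane, 0 < a.2 → 0 < c.2 → Submodule.span ℤ {a, c} = L →
      |a.1| + |c.1| + a.2 + c.2 < n * ε → (biFan L).Nonempty := by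
  induction n with
  | zero =>
    intro a c ha hc _ hlt
    have h1 := abs_nonneg a.1
    have h2 := abs_nonneg c.1
    rw [Nat.cast_zero, zero_mul] at hlt
    linarith
  | succ n ih =>
    intro a c ha hc hspan hlt
    wlog hca : c.2 ≤ a.2 generalizing a c
    · exact this c a hc ha (by rwa [pair_comm]) (by linarith) (not_le.1 hca).le
    obtain ⟨haL, hcL⟩ := mem_and_mem_of_span_pair_eq hspan
    have hc0 : c ≠ 0 := by rintro rfl; exact hc.false
    have hac0 : a - c ≠ 0 := by
      intro h
      rw [sub_eq_zero.1 h, pair_eq_singleton] at hspan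
      exact D.span_singleton_ne hL hc0 hspan
    have hac1 : (a - c).1 ≠ 0 := mt (hL.eq_zero_of_fst _ (L.sub_mem haL hcL)) hac0
    have hac2 : (a - c).2 ≠ 0 := mt (hL.eq_zero_of_snd _ (L.sub_mem haL hcL)) hac0
    have hac : 0 < (a - c).2 := lt_of_le_of_ne (sub_nonneg.2 hca) hac2.symm
    have hspan' : Submodule.span ℤ {a - c, c} = L := (span_pair_sub_left a c).trans hspan
    rcases lt_or_gt_of_ne (mul_ne_zero hac1 (mt (hL.eq_zero_of_fst c hcL) hc0)) with h | h
    · exact biFan_nonempty_of_fst_mul_neg h hac hc hspan'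
    · refine ih (a - c) c hac hc hspan' ?_
      have hcε := hε c hcL hc0
      rw [abs_of_pos hc] at hcε
      rw [Prod.fst_sub, Prod.snd_sub, abs_sub_eq_of_mul_pos h]
      push_cast at hlt
      linarith

lemma exists_span_pair_eq_pos_snd [DiscreteTopology L] [IsZLattice ℝ L]
    (hL : ∀ l ∈ L, l.2 = 0 → l = 0) :
    ∃ a c : Plane, 0 < a.2 ∧ 0 < c.2 ∧ Submodule.span ℤ {a, c} = L := by
  have := ZLattice.module_free ℝ L
  have := ZLattice.module_finite ℝ L
  let B := Module.finBasisOfFinrankEq ℤ L (show Module.finrank ℤ L = 2 by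
    rw [ZLattice.rank ℝ L, Module.finrank_prod, Module.finrank_self])
  have hsign : ∀ i, ∃ s : ℤˣ, 0 < (s • (B i : Plane)).2 := by
    intro i
    have hi : (B i : Plane).2 ≠ 0 := fun h =>
      B.ne_zero i (Subtype.ext (hL _ (B i).2 h))
    rcases lt_or_gt_of_ne hi with h | h
    · exact ⟨-1, by simpa using h⟩
    · exact ⟨1, by simpa using h⟩
  choose s hs using hsign
  refine ⟨_, _, ?_, ?_, span_pair_eq_of_basis (B.unitsSMul s)⟩
  · simpa [Module.Basis.unitsSMul_apply] using hs 0
  · simpa [Module.Basis.unitsSMul_apply] using hs 1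

theorem biFan_nonempty [DiscreteTopology L] [IsZLattice ℝ L] (D : HyperbolicToralAut L) :
    (biFan L).Nonempty := by
  obtain ⟨ε, hε, hnorm⟩ := exists_pos_forall_le_norm L
  have hle : ∀ l ∈ L, l ≠ 0 → ε ≤ |l.1| + |l.2| := fun l hl hl0 =>
    (hnorm l hl hl0).trans (max_le_add_of_nonneg (abs_nonneg _) (abs_nonneg _))
  obtain ⟨a, c, ha, hc, hspan⟩ := exists_span_pair_eq_pos_snd D.axisFree.eq_zero_of_snd
  obtain ⟨n, hn⟩ := exists_nat_gt ((|a.1| + |c.1| + a.2 + c.2) / ε)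
  exact biFan_nonempty_of_pos_snd D D.axisFree hle n a c ha hc hspan ((div_lt_iff₀ hε).1 hn)

end BiFan

/-! ### Homeomorphisms commuting with a hyperbolic automorphism -/

lemma mkQ_eq_mkQ_iff {E : Type*} [AddCommGroup E] {L : Submodule ℤ E} {z w : E} :
    L.mkQ z = L.mkQ w ↔ z - w ∈ L :=
  Submodule.Quotient.eq L

lemma mkQ_add_of_mem {E : Type*} [AddCommGroup E] {L : Submodule ℤ E} (z : E) {l : E}
    (hl : l ∈ L) : L.mkQ (z + l) = L.mkQ z :=
  mkQ_eq_mkQ_iff.2 (by rwa [add_sub_cancel_left])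

section Lift

variable {E : Type*} [NormedAddCommGroup E] {L : Submodule ℤ E} [DiscreteTopology L]

lemma isCoveringMap_mkQ : IsCoveringMap L.mkQ :=
  (AddSubgroup.isAddQuotientCoveringMap_of_comm L.toAddSubgroup ⟨‹_›⟩).isCoveringMap

lemma exists_continuous_lift_mkQ {X : Type*} [TopologicalSpace X] [SimplyConnectedSpace X]
    [LocallyPathConnectedSpace X] {f : X → E ⧸ L} (hf : Continuous f) :
    ∃ F : X → E, Continuous F ∧ ∀ x, L.mkQ (F x) = f x := by
  obtain ⟨x₀⟩ : Nonempty X := inferInstance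
  obtain ⟨e₀, he₀⟩ := L.mkQ_surjective (f x₀)
  obtain ⟨F, ⟨-, hF⟩, -⟩ :=
    isCoveringMap_mkQ.existsUnique_continuousMap_lifts ⟨f, hf⟩ x₀ e₀ he₀
  exact ⟨F, F.continuous, congrFun hF⟩

lemma sub_eq_sub_of_mkQ_eq {X : Type*} [TopologicalSpace X] [PreconnectedSpace X] {F G : X → E}
    (hF : Continuous F) (hG : Continuous G) (h : ∀ x, L.mkQ (F x) = L.mkQ (G x)) (x y : X) :
    F x - G x = F y - G y := by
  have hmem : ∀ x, F x - G x ∈ L := fun x => mkQ_eq_mkQ_iff.1 (h x)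
  have hcont : Continuous fun x => (⟨F x - G x, hmem x⟩ : L) := (hF.sub hG).subtype_mk hmem
  exact congrArg Subtype.val (PreconnectedSpace.constant inferInstance hcont (x := x) (y := y))

lemma exists_addMonoidHom_of_lift [NormedSpace ℝ E] {H : E → E} (hH : Continuous H)
    {h : E ⧸ L → E ⧸ L} (hlift : ∀ z, L.mkQ (H z) = h (L.mkQ z)) :
    ∃ A : L →+ E, ∀ (l : L) (z : E), H (z + l) = H z + A l := by
  have hconst : ∀ (l : L) (z : E), H (z + l) - H z = H l - H 0 := fun l z => by
    simpa using sub_eq_sub_of_mkQ_eq (F := fun z => H (z + l)) (by fun_prop) hH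
      (fun z => by rw [hlift, hlift, mkQ_add_of_mem z l.2]) z 0
  refine ⟨⟨⟨fun l => H l - H 0, by simp⟩, fun l m => ?_⟩, fun l z => ?_⟩
  · change H (l + m : L) - H 0 = H l - H 0 + (H m - H 0)
    rw [← hconst m l, Submodule.coe_add]
    abel
  · change H (z + l) = H z + (H l - H 0)
    rw [← hconst l z]
    abel

end Lift

lemma eq_zero_of_periodic_of_comp_eq_mul {E : Type*} [NormedAddCommGroup E] [NormedSpace ℝ E]
    [FiniteDimensional ℝ E] {L : Submodule ℤ E} [DiscreteTopology L] [IsZLattice ℝ L] {g : E → ℝ}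
    (hg : Continuous g) (hper : ∀ l ∈ L, ∀ z, g (z + l) = g z) {T : E → E}
    (hT : Function.Surjective T) {r : ℝ} (hr : |r| ≠ 1) (hgT : ∀ z, g (T z) = r * g z) (z : E) :
    g z = 0 := by
  obtain ⟨z₀, hmax⟩ := exists_forall_abs_le_of_periodic hg hper
  obtain ⟨w, hw⟩ := hT z₀
  have hTz₀ : |r| * |g z₀| ≤ |g z₀| := by rw [← abs_mul, ← hgT]; exact hmax _
  have hz₀ : |g z₀| ≤ |r| * |g z₀| := by
    conv_lhs => rw [← hw, hgT, abs_mul]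
    exact mul_le_mul_of_nonneg_left (hmax w) (abs_nonneg r)
  have h0 : |g z₀| = 0 := by
    by_contra h0
    exact hr ((mul_eq_right₀ h0).1 (le_antisymm hTz₀ hz₀))
  exact abs_nonpos_iff.1 (h0 ▸ hmax z)

section BiFanBasis

variable {L : Submodule ℤ Plane} {b : Plane × Plane}

lemma fst_mem_of_mem_biFan (hb : b ∈ biFan L) : b.1 ∈ L :=
  (mem_and_mem_of_span_pair_eq hb.2.2.2.2).1

lemma snd_mem_of_mem_biFan (hb : b ∈ biFan L) : b.2 ∈ L :=
  (mem_and_mem_of_span_pair_eq hb.2.2.2.2).2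

lemma mem_iff_of_mem_biFan (hb : b ∈ biFan L) {z : Plane} :
    z ∈ L ↔ ∃ m n : ℤ, z.1 = m * b.1.1 + n * b.2.1 ∧ z.2 = m * b.1.2 + n * b.2.2 := by
  rw [← mem_span_pair_iff_coord, hb.2.2.2.2]

lemma det_pos_of_mem_biFan (hb : b ∈ biFan L) : 0 < b.1.1 * b.2.2 - b.1.2 * b.2.1 := by
  obtain ⟨he1, he2, hf1, hf2, -⟩ := hb
  have h1 := mul_pos he1 hf2
  have h2 := mul_neg_of_pos_of_neg he2 hf1
  linarith

end BiFanBasis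

lemma eq_div_mul_of_eigen_relation {r x y u v u' v' : ℝ} (hy : y ≠ 0) (hu : u ≠ 0)
    (h : r * u = x * u + y * v) (h' : r * u' = x * u' + y * v') : v' = u' / u * v := by
  apply mul_left_cancel₀ (mul_ne_zero hy hu)
  rw [show y * u * (u' / u * v) = y * v * (u' / u * u) by ring, div_mul_cancel₀ _ hu]
  linear_combination u' * h - u * h'

namespace HyperbolicToralAut

variable {L : Submodule ℤ Plane} (D : HyperbolicToralAut L) {b : Plane × Plane}

lemma exists_planeMap_fst_eq (hb : b ∈ biFan L) :
    ∃ m n : ℤ, n ≠ 0 ∧ D.planeMap b.1 = m • b.1 + n • b.2 := by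
  have hDb : D.planeMap b.1 ∈ Submodule.span ℤ {b.1, b.2} :=
    hb.2.2.2.2.ge (D.planeMap_mem_iff.2 (fst_mem_of_mem_biFan hb))
  obtain ⟨m, n, hmn⟩ := Submodule.mem_span_pair.1 hDb
  refine ⟨m, n, ?_, hmn.symm⟩
  rintro rfl
  rw [zero_smul, add_zero] at hmn
  exact D.planeMap_ne_zsmul hb.1.ne' hb.2.1.ne' m hmn.symm

lemma exists_coord_planeMap_fst_eq (hb : b ∈ biFan L) :
    ∃ m n : ℤ, (n : ℝ) ≠ 0 ∧ D.mu * b.1.1 = m * b.1.1 + n * b.2.1 ∧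
      D.lam * b.1.2 = m * b.1.2 + n * b.2.2 := by
  obtain ⟨m, n, hn, h⟩ := D.exists_planeMap_fst_eq hb
  refine ⟨m, n, Int.cast_ne_zero.2 hn, ?_, ?_⟩
  · simpa [D.planeMap_apply, ← Int.cast_smul_eq_zsmul ℝ] using congrArg Prod.fst h
  · simpa [D.planeMap_apply, ← Int.cast_smul_eq_zsmul ℝ] using congrArg Prod.snd h

lemma exists_eq_mul_of_map_planeMap (hb : b ∈ biFan L) {π : Plane →+ ℝ} {r : ℝ}
    (hπ : ∀ z, π (D.planeMap z) = r * π z) (hπb : π b.1 ≠ 0) {a : L →+ ℝ}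
    (ha : ∀ l l' : L, (l' : Plane) = D.planeMap l → a l' = r * a l) :
    ∃ α : ℝ, ∀ l : L, a l = α * π l := by
  obtain ⟨m, n, hn, hmn⟩ := D.exists_planeMap_fst_eq hb
  let e : L := ⟨b.1, fst_mem_of_mem_biFan hb⟩
  let f : L := ⟨b.2, snd_mem_of_mem_biFan hb⟩
  have hπe : r * π b.1 = m * π b.1 + n * π b.2 := by
    rw [← hπ, hmn, map_add, map_zsmul, map_zsmul, zsmul_eq_mul, zsmul_eq_mul]
  have hae : r * a e = m * a e + n * a f := by
    rw [← ha e (m • e + n • f) hmn.symm, map_add, map_zsmul, map_zsmul, zsmul_eq_mul, zsmul_eq_mul]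
  have haf : a f = a e / π b.1 * π b.2 :=
    eq_div_mul_of_eigen_relation (Int.cast_ne_zero.2 hn) hπb hπe hae
  refine ⟨a e / π b.1, fun l => ?_⟩
  obtain ⟨m', n', hl⟩ := Submodule.mem_span_pair.1 (hb.2.2.2.2.ge l.2)
  have hlL : l = m' • e + n' • f := Subtype.ext hl.symm
  rw [← hl, hlL, map_add, map_add, map_zsmul, map_zsmul, map_zsmul, map_zsmul, haf,
    ← div_mul_cancel₀ (a e) hπb]
  simp only [zsmul_eq_mul, mul_div_cancel_right₀ _ hπb]
  ring

end HyperbolicToralAut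

section Affine

variable {L : Submodule ℤ Plane} [DiscreteTopology L] [IsZLattice ℝ L]

lemma HyperbolicToralAut.exists_affine_functional (D : HyperbolicToralAut L) {H : Plane → Plane}
    (hH : Continuous H) {A : L →+ Plane} (hA : ∀ (l : L) (z : Plane), H (z + l) = H z + A l)
    {c : Plane} (hc : ∀ z, H (D.planeMap z) = D.planeMap (H z) + c) {π : Plane →+ ℝ}
    (hπc : Continuous π) {r : ℝ} (hr : |r| ≠ 1) (hπ : ∀ z, π (D.planeMap z) = r * π z)
    (hπ0 : ∀ l ∈ L, π l = 0 → l = 0) : ∃ α γ : ℝ, ∀ z, π (H z) = α * π z + γ := by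
  obtain ⟨b, hb⟩ := biFan_nonempty D
  have hπb : π b.1 ≠ 0 := fun h =>
    hb.1.ne' (congrArg Prod.fst (hπ0 b.1 (fst_mem_of_mem_biFan hb) h))
  have hAD : ∀ l l' : L, (l' : Plane) = D.planeMap l → A l' = D.planeMap (A l) := by
    intro l l' hl
    have h := hc (0 + l)
    rw [map_add, ← hl, hA, hA, map_add, hc] at h
    linear_combination (exp := 1) h
  obtain ⟨α, hα⟩ := D.exists_eq_mul_of_map_planeMap hb hπ hπb (a := π.comp A)
    fun l l' hl => by rw [AddMonoidHom.comp_apply, hAD l l' hl, hπ, AddMonoidHom.comp_apply]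
  have hr1 : 1 - r ≠ 0 := fun h => hr (by rw [← sub_eq_zero.1 h, abs_one])
  refine ⟨α, π c / (1 - r), fun z => ?_⟩
  have hzero := eq_zero_of_periodic_of_comp_eq_mul (L := L)
    (g := fun z => π (H z) - α * π z - π c / (1 - r)) (by fun_prop)
    (fun l hl z => by
      have hl' : π (A ⟨l, hl⟩) = α * π l := hα ⟨l, hl⟩
      rw [hA ⟨l, hl⟩ z, map_add, map_add, hl']
      ring)
    D.planeMap_surjective hr (fun z => by
      rw [hc, map_add, hπ, hπ]
      linear_combination -div_mul_cancel₀ (π c) hr1) z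
  linear_combination hzero

theorem HyperbolicToralAut.exists_affine_of_commute (D : HyperbolicToralAut L)
    {h : (Plane ⧸ L) ≃ₜ (Plane ⧸ L)} (hD : ∀ x, h (D.torusMap x) = D.torusMap (h x)) :
    ∃ α β : ℝ, ∃ c : Plane, α ≠ 0 ∧ β ≠ 0 ∧
      ∀ z : Plane, h (L.mkQ z) = L.mkQ (α * z.1 + c.1, β * z.2 + c.2) := by
  obtain ⟨H, hHcont, hH⟩ :=
    exists_continuous_lift_mkQ (h.continuous.comp (isCoveringMap_mkQ (L := L)).continuous)
  obtain ⟨A, hA⟩ := exists_addMonoidHom_of_lift hHcont (h := h) hH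
  have hDcont := D.continuous_planeMap
  have hHD : ∀ z, H (D.planeMap z) = D.planeMap (H z) + (H (D.planeMap 0) - D.planeMap (H 0)) :=
    fun z => sub_eq_iff_eq_add'.1 <| sub_eq_sub_of_mkQ_eq (L := L) (hHcont.comp hDcont)
      (hDcont.comp hHcont) (fun z => by
        simp only [Function.comp_apply, ← D.torusMap_mkQ, hH, hD]) z 0
  obtain ⟨α, c₁, h₁⟩ := D.exists_affine_functional hHcont hA hHD (π := AddMonoidHom.fst ℝ ℝ)
    continuous_fst D.abs_mu_lt_one.ne (fun _ => rfl) D.axisFree.eq_zero_of_fst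
  obtain ⟨β, c₂, h₂⟩ := D.exists_affine_functional hHcont hA hHD (π := AddMonoidHom.snd ℝ ℝ)
    continuous_snd D.one_lt_abs_lam.ne' (fun _ => rfl) D.axisFree.eq_zero_of_snd
  have hform : ∀ z : Plane, h (L.mkQ z) = L.mkQ (α * z.1 + c₁, β * z.2 + c₂) := fun z =>
    (hH z).symm.trans (congrArg L.mkQ (Prod.ext (h₁ z) (h₂ z)))
  refine ⟨α, β, (c₁, c₂), ?_, ?_, hform⟩
  · rintro rfl
    have hx : L.mkQ ((1, 0) : Plane) = L.mkQ 0 := h.injective (by rw [hform, hform]; simp)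
    rw [mkQ_eq_mkQ_iff, sub_zero] at hx
    exact one_ne_zero (congrArg Prod.fst (D.axisFree.eq_zero_of_snd _ hx rfl))
  · rintro rfl
    have hy : L.mkQ ((0, 1) : Plane) = L.mkQ 0 := h.injective (by rw [hform, hform]; simp)
    rw [mkQ_eq_mkQ_iff, sub_zero] at hy
    exact one_ne_zero (congrArg Prod.snd (D.axisFree.eq_zero_of_fst _ hy rfl))

end Affine

/-! ### The cutting algorithm -/

section Cutting

variable {L : Submodule ℤ Plane} {b b' : Plane × Plane}

lemma cutForward_of_pos (h : 0 < (b.1 + b.2).1) : cutForward b = (b.1 + b.2, b.2) :=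
  if_pos h

lemma cutForward_of_not_pos (h : ¬ 0 < (b.1 + b.2).1) : cutForward b = (b.1, b.1 + b.2) :=
  if_neg h

lemma cutBackward_of_pos (h : 0 < (b.1 - b.2).2) : cutBackward b = (b.1 - b.2, b.2) :=
  if_pos h

lemma cutBackward_of_not_pos (h : ¬ 0 < (b.1 - b.2).2) : cutBackward b = (b.1, b.2 - b.1) :=
  if_neg h

lemma fst_add_ne_zero_of_mem_biFan (hL : AxisFree L) (hb : b ∈ biFan L) : (b.1 + b.2).1 ≠ 0 := by
  intro h
  have h0 := hL.eq_zero_of_fst _ (L.add_mem (fst_mem_of_mem_biFan hb) (snd_mem_of_mem_biFan hb)) h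
  exact (add_pos hb.2.1 hb.2.2.2.1).ne' (congrArg Prod.snd h0)

lemma snd_sub_ne_zero_of_mem_biFan (hL : AxisFree L) (hb : b ∈ biFan L) : (b.1 - b.2).2 ≠ 0 := by
  intro h
  have h0 := hL.eq_zero_of_snd _ (L.sub_mem (fst_mem_of_mem_biFan hb) (snd_mem_of_mem_biFan hb)) h
  exact (sub_pos.2 (hb.2.2.1.trans hb.1)).ne' (congrArg Prod.fst h0)

lemma cutForward_mem_biFan (hL : AxisFree L) (hb : b ∈ biFan L) : cutForward b ∈ biFan L := by
  have hne := fst_add_ne_zero_of_mem_biFan hL hb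
  obtain ⟨he1, he2, hf1, hf2, hspan⟩ := hb
  by_cases h : 0 < (b.1 + b.2).1
  · rw [cutForward_of_pos h]
    refine ⟨h, add_pos he2 hf2, hf1, hf2, ?_⟩
    rw [← hspan, ← span_pair_sub_left (b.1 + b.2), add_sub_cancel_right]
  · rw [cutForward_of_not_pos h]
    refine ⟨he1, he2, lt_of_le_of_ne (not_lt.1 h) hne, add_pos he2 hf2, ?_⟩
    rw [← hspan, ← span_pair_sub_right, add_sub_cancel_left]

lemma cutBackward_mem_biFan (hL : AxisFree L) (hb : b ∈ biFan L) : cutBackward b ∈ biFan L := by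
  have hne := snd_sub_ne_zero_of_mem_biFan hL hb
  obtain ⟨he1, he2, hf1, hf2, hspan⟩ := hb
  by_cases h : 0 < (b.1 - b.2).2
  · rw [cutBackward_of_pos h]
    exact ⟨sub_pos.2 (hf1.trans he1), h, hf1, hf2, by rw [span_pair_sub_left, hspan]⟩
  · rw [cutBackward_of_not_pos h]
    exact ⟨he1, he2, sub_neg.2 (hf1.trans he1),
      sub_pos.2 (sub_neg.1 (lt_of_le_of_ne (not_lt.1 h) hne)), by rw [span_pair_sub_right, hspan]⟩

lemma cutBackward_cutForward (hb : b ∈ biFan L) : cutBackward (cutForward b) = b := by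
  obtain ⟨-, he2, -, hf2, -⟩ := hb
  by_cases h : 0 < (b.1 + b.2).1
  · rw [cutForward_of_pos h, cutBackward_of_pos (by simpa using he2), add_sub_cancel_right]
  · rw [cutForward_of_not_pos h, cutBackward_of_not_pos (by simpa using hf2.le),
      add_sub_cancel_left]

lemma cutForward_cutBackward (hb : b ∈ biFan L) : cutForward (cutBackward b) = b := by
  obtain ⟨he1, -, hf1, -, -⟩ := hb
  by_cases h : 0 < (b.1 - b.2).2
  · rw [cutBackward_of_pos h, cutForward_of_pos (by simpa using he1), sub_add_cancel]
  · rw [cutBackward_of_not_pos h, cutForward_of_not_pos (by simpa using hf1.le), add_sub_cancel]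

lemma iterate_cutForward_mem_biFan (hL : AxisFree L) (hb : b ∈ biFan L) (n : ℕ) :
    cutForward^[n] b ∈ biFan L :=
  (show MapsTo cutForward (biFan L) (biFan L) from fun _ => cutForward_mem_biFan hL).iterate n hb

lemma iterate_cutBackward_mem_biFan (hL : AxisFree L) (hb : b ∈ biFan L) (n : ℕ) :
    cutBackward^[n] b ∈ biFan L :=
  (show MapsTo cutBackward (biFan L) (biFan L) from fun _ => cutBackward_mem_biFan hL).iterate n hb

lemma cutBasis_mem_biFan (hL : AxisFree L) (hb : b ∈ biFan L) : ∀ n : ℤ, cutBasis b n ∈ biFan L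
  | Int.ofNat n => iterate_cutForward_mem_biFan hL hb n
  | Int.negSucc n => iterate_cutBackward_mem_biFan hL hb (n + 1)

lemma cutBasis_neg_natCast : ∀ n : ℕ, cutBasis b (-(n : ℤ)) = cutBackward^[n] b
  | 0 => rfl
  | _ + 1 => rfl

lemma cutBasis_add_one (hL : AxisFree L) (hb : b ∈ biFan L) (n : ℤ) :
    cutBasis b (n + 1) = cutForward (cutBasis b n) := by
  cases n with
  | ofNat n => exact Function.iterate_succ_apply' cutForward n b
  | negSucc n =>
    have hn : Int.negSucc n + 1 = -(n : ℤ) := by omega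
    rw [hn, cutBasis_neg_natCast, cutBasis, Function.iterate_succ_apply',
      cutForward_cutBackward (iterate_cutBackward_mem_biFan hL hb n)]

lemma cutBasis_sub_one (hL : AxisFree L) (hb : b ∈ biFan L) (n : ℤ) :
    cutBasis b (n - 1) = cutBackward (cutBasis b n) := by
  rw [← cutBackward_cutForward (cutBasis_mem_biFan hL hb (n - 1)), ← cutBasis_add_one hL hb,
    sub_add_cancel]

lemma cuttingSeq_eq_ite (hL : AxisFree L) (hb : b ∈ biFan L) (n : ℤ)
    [Decidable (0 < ((cutBasis b n).1 + (cutBasis b n).2).1)] :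
    cuttingSeq b n = if 0 < ((cutBasis b n).1 + (cutBasis b n).2).1 then 1 else 0 := by
  have he1 := (cutBasis_mem_biFan hL hb n).1.ne'
  rw [cuttingSeq, cutBasis_add_one hL hb]
  by_cases h : 0 < ((cutBasis b n).1 + (cutBasis b n).2).1
  · rw [cutForward_of_pos h, if_pos rfl, if_pos h]
  · rw [cutForward_of_not_pos h, if_neg h, if_neg]
    exact fun h0 => he1 (congrArg Prod.fst (add_eq_right.1 h0))

/-! ### The cutting algorithm reaches every basis of the bi-fan -/

lemma exists_coord_of_mem_biFan (hb : b ∈ biFan L) (hb' : b' ∈ biFan L) :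
    ∃ a c a' c' : ℤ, b'.1 = a • b.1 + c • b.2 ∧ b'.2 = a' • b.1 + c' • b.2 ∧
      a * c' - c * a' = 1 := by
  have coord {b b' : Plane × Plane} (hb : b ∈ biFan L) (hb' : b' ∈ biFan L) :
      ∃ a c a' c' : ℤ, b'.1 = a • b.1 + c • b.2 ∧ b'.2 = a' • b.1 + c' • b.2 ∧
        b'.1.1 * b'.2.2 - b'.1.2 * b'.2.1 =
          (a * c' - c * a' : ℤ) * (b.1.1 * b.2.2 - b.1.2 * b.2.1) := by
    obtain ⟨a, c, h1⟩ := Submodule.mem_span_pair.1 (hb.2.2.2.2.ge (fst_mem_of_mem_biFan hb'))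
    obtain ⟨a', c', h2⟩ := Submodule.mem_span_pair.1 (hb.2.2.2.2.ge (snd_mem_of_mem_biFan hb'))
    refine ⟨a, c, a', c', h1.symm, h2.symm, ?_⟩
    simp only [← h1, ← h2, ← Int.cast_smul_eq_zsmul ℝ, Prod.fst_add, Prod.snd_add, Prod.smul_fst,
      Prod.smul_snd, smul_eq_mul]
    push_cast
    ring
  obtain ⟨a, c, a', c', h1, h2, hdet⟩ := coord hb hb'
  obtain ⟨x, y, x', y', -, -, hdet'⟩ := coord hb' hb
  have hpos := det_pos_of_mem_biFan hb
  have hpos' := det_pos_of_mem_biFan hb'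
  refine ⟨a, c, a', c', h1, h2, ?_⟩
  have hk : 0 < a * c' - c * a' :=
    Int.cast_pos.1 (pos_of_mul_pos_left (hdet ▸ hpos') hpos.le)
  refine (Int.eq_one_or_neg_one_of_mul_eq_one (v := x * y' - y * x') ?_).resolve_right (by omega)
  have hkk : ((a * c' - c * a' : ℤ) * (x * y' - y * x' : ℤ) : ℝ) = 1 := by
    rw [hdet', ← mul_assoc] at hdet
    exact mul_right_cancel₀ hpos'.ne' (hdet.symm.trans (one_mul _).symm)
  exact_mod_cast hkk

lemma coord_signs_of_mem_biFan (hb : b ∈ biFan L) (hb' : b' ∈ biFan L) {a c a' c' : ℤ}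
    (h1 : b'.1 = a • b.1 + c • b.2) (h2 : b'.2 = a' • b.1 + c' • b.2)
    (hdet : a * c' - c * a' = 1) :
    0 < a ∧ 0 < c' ∧ (0 ≤ c ∧ 0 ≤ a' ∨ c ≤ 0 ∧ a' ≤ 0) := by
  obtain ⟨he1, he2, hf1, hf2, -⟩ := hb
  obtain ⟨he1', he2', hf1', hf2', -⟩ := hb'
  simp only [h1, h2, ← Int.cast_smul_eq_zsmul ℝ, Prod.fst_add, Prod.snd_add, Prod.smul_fst,
    Prod.smul_snd, smul_eq_mul] at he1' he2' hf1' hf2'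
  have ha : 0 < a := by
    by_contra! h
    rcases le_total c 0 with hc | hc <;> rify at h hc <;> nlinarith
  have hc' : 0 < c' := by
    by_contra! h
    rcases le_total a' 0 with ha' | ha' <;> rify at h ha' <;> nlinarith
  exact ⟨ha, hc', mul_nonneg_iff.1 (by nlinarith)⟩

lemma nat_cases_of_det_eq_one {a b c d : ℕ} (h : a * d = b * c + 1) :
    (a = 1 ∧ b = 0 ∧ c = 0 ∧ d = 1) ∨ (c ≤ a ∧ d ≤ b) ∨ (a ≤ c ∧ b ≤ d) := by
  rcases lt_or_ge a c with hac | hca <;> rcases lt_or_ge b d with hbd | hdb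
  · exact .inr (.inr ⟨hac.le, hbd.le⟩)
  · nlinarith
  · have ha : a = 1 := by
      have : 0 < a := Nat.pos_of_ne_zero (by rintro rfl; omega)
      nlinarith
    subst ha
    interval_cases c <;> omega
  · exact .inr (.inl ⟨hca, hdb⟩)

lemma exists_eq_iterate_cutForward (hL : AxisFree L) (hb : b ∈ biFan L) (hb' : b' ∈ biFan L)
    {a c a' c' : ℕ} (h1 : b'.1 = a • b.1 + c • b.2) (h2 : b'.2 = a' • b.1 + c' • b.2)
    (hdet : a * c' = c * a' + 1) : ∃ n : ℕ, b' = cutForward^[n] b := by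
  induction hN : a + c + a' + c' using Nat.strong_induction_on generalizing b' a c a' c' with
  | _ N ih =>
  have snd_nonneg (x y : ℕ) : 0 ≤ (x • b.1 + y • b.2).2 :=
    add_nonneg (nsmul_nonneg hb.2.1.le x) (nsmul_nonneg hb.2.2.2.1.le y)
  have of_cutBackward (h : ∃ n : ℕ, cutBackward b' = cutForward^[n] b) :
      ∃ n : ℕ, b' = cutForward^[n] b := by
    obtain ⟨n, hn⟩ := h
    exact ⟨n + 1, by rw [Function.iterate_succ_apply', ← hn, cutForward_cutBackward hb']⟩
  have hmem := cutBackward_mem_biFan hL hb'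
  rcases nat_cases_of_det_eq_one hdet with ⟨rfl, rfl, rfl, rfl⟩ | ⟨ha, hc⟩ | ⟨ha, hc⟩
  · exact ⟨0, Prod.ext (by simpa using h1) (by simpa using h2)⟩
  · obtain ⟨x, rfl⟩ := Nat.exists_eq_add_of_le ha
    obtain ⟨y, rfl⟩ := Nat.exists_eq_add_of_le hc
    have hsub : b'.1 - b'.2 = x • b.1 + y • b.2 := by rw [h1, h2]; module
    have hpos : 0 < (b'.1 - b'.2).2 :=
      lt_of_le_of_ne (hsub ▸ snd_nonneg x y) (snd_sub_ne_zero_of_mem_biFan hL hb').symm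
    have hc' : c' ≠ 0 := by rintro rfl; omega
    rw [cutBackward_of_pos hpos] at of_cutBackward hmem
    exact of_cutBackward (ih (x + y + a' + c') (by omega) hmem hsub h2 (by linarith) rfl)
  · obtain ⟨x, rfl⟩ := Nat.exists_eq_add_of_le ha
    obtain ⟨y, rfl⟩ := Nat.exists_eq_add_of_le hc
    have hsub : b'.2 - b'.1 = x • b.1 + y • b.2 := by rw [h1, h2]; module
    have hpos : ¬ 0 < (b'.1 - b'.2).2 := by
      rw [← neg_sub b'.2, hsub, Prod.snd_neg, neg_pos, not_lt]
      exact snd_nonneg x y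
    have ha' : a ≠ 0 := by rintro rfl; omega
    rw [cutBackward_of_not_pos hpos] at of_cutBackward hmem
    exact of_cutBackward (ih (a + c + x + y) (by omega) hmem h1 hsub (by linarith) rfl)

lemma iterate_cutBackward_iterate_cutForward (hL : AxisFree L) (hb : b ∈ biFan L) (n : ℕ) :
    cutBackward^[n] (cutForward^[n] b) = b := by
  induction n with
  | zero => rfl
  | succ n ih =>
    rw [Function.iterate_succ_apply, Function.iterate_succ_apply',
      cutBackward_cutForward (iterate_cutForward_mem_biFan hL hb n), ih]

theorem exists_eq_cutBasis (hL : AxisFree L) (hb : b ∈ biFan L) (hb' : b' ∈ biFan L) :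
    ∃ n : ℤ, b' = cutBasis b n := by
  obtain ⟨a, c, a', c', h1, h2, hdet⟩ := exists_coord_of_mem_biFan hb hb'
  obtain ⟨ha, hc', hsign⟩ := coord_signs_of_mem_biFan hb hb' h1 h2 hdet
  lift a to ℕ using ha.le
  lift c' to ℕ using hc'.le
  rcases hsign with ⟨hc, ha'⟩ | ⟨hc, ha'⟩
  · lift c to ℕ using hc
    lift a' to ℕ using ha'
    simp only [natCast_zsmul] at h1 h2
    obtain ⟨n, hn⟩ := exists_eq_iterate_cutForward hL hb hb' h1 h2 (by lia)
    exact ⟨n, hn⟩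
  · obtain ⟨x, rfl⟩ := Int.exists_eq_neg_ofNat hc
    obtain ⟨y, rfl⟩ := Int.exists_eq_neg_ofNat ha'
    have hinv1 : b.1 = c' • b'.1 + x • b'.2 := by
      rw [h1, h2]
      linear_combination (exp := 1) (-hdet) • b.1
    have hinv2 : b.2 = y • b'.1 + a • b'.2 := by
      rw [h1, h2]
      linear_combination (exp := 1) (-hdet) • b.2
    obtain ⟨n, hn⟩ := exists_eq_iterate_cutForward hL hb' hb hinv1 hinv2 (by lia)
    refine ⟨-n, ?_⟩
    rw [cutBasis_neg_natCast, hn, iterate_cutBackward_iterate_cutForward hL hb']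

end Cutting

/-! ### Diagonal maps and shifts of the cutting sequence -/

/-- The linear map `diag(α, β)` of the plane. -/
def diagMap (α β : ℝ) : Plane →ₗ[ℝ] Plane where
  toFun z := (α * z.1, β * z.2)
  map_add' z w := by ext <;> simp [mul_add]
  map_smul' a z := by ext <;> simp [mul_left_comm]

/-- The image of a pair of vectors under `diag(α, β)`. -/
def diagPair (α β : ℝ) (b : Plane × Plane) : Plane × Plane :=
  (diagMap α β b.1, diagMap α β b.2)

/-- The image of a pair of vectors under the reflection in the vertical axis. The two vectors are
swapped, so that the image of a basis in the bi-fan of a lattice is in the bi-fan of the reflected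
lattice. -/
def mirror (b : Plane × Plane) : Plane × Plane :=
  (diagMap (-1) 1 b.2, diagMap (-1) 1 b.1)

/-- A diagonal map, with positive second entry, takes one basis of the bi-fan into the other,
possibly after a reflection in the vertical axis. -/
def DiagRel (b b' : Plane × Plane) : Prop :=
  ∃ α β : ℝ, 0 < α ∧ 0 < β ∧ (b' = diagPair α β b ∨ b' = diagPair α β (mirror b))

section DiagMap

variable {α β : ℝ}

lemma diagMap_apply (z : Plane) : diagMap α β z = (α * z.1, β * z.2) := rfl

lemma diagMap_inv_apply_diagMap (hα : α ≠ 0) (hβ : β ≠ 0) (z : Plane) :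
    diagMap α⁻¹ β⁻¹ (diagMap α β z) = z :=
  Prod.ext (inv_mul_cancel_left₀ hα _) (inv_mul_cancel_left₀ hβ _)

lemma diagMap_apply_diagMap_inv (hα : α ≠ 0) (hβ : β ≠ 0) (z : Plane) :
    diagMap α β (diagMap α⁻¹ β⁻¹ z) = z :=
  Prod.ext (mul_inv_cancel_left₀ hα _) (mul_inv_cancel_left₀ hβ _)

lemma diagMap_injective (hα : α ≠ 0) (hβ : β ≠ 0) : Function.Injective (diagMap α β) :=
  Function.LeftInverse.injective (diagMap_inv_apply_diagMap hα hβ)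

lemma diagPair_mirror (b : Plane × Plane) : diagPair α β (mirror b) = mirror (diagPair α β b) := by
  simp only [diagPair, mirror, diagMap_apply, mul_left_comm]

lemma exists_eq_diagMap_of_commute {r s : ℝ} (hrs : r ≠ s) {A : Plane →ₗ[ℝ] Plane}
    (hA : A ∘ₗ diagMap r s = diagMap r s ∘ₗ A) : ∃ α β : ℝ, A = diagMap α β := by
  have hfix (z : Plane) : A (diagMap r s z) = diagMap r s (A z) := LinearMap.congr_fun hA z
  have hx : (A (1, 0)).2 = 0 := by
    have h := congrArg Prod.snd (hfix (1, 0))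
    rw [show diagMap r s (1, 0) = r • (1, 0) by simp [diagMap_apply], map_smul, Prod.smul_snd,
      smul_eq_mul, diagMap_apply, mul_eq_mul_right_iff] at h
    exact h.resolve_left hrs
  have hy : (A (0, 1)).1 = 0 := by
    have h := congrArg Prod.fst (hfix (0, 1))
    rw [show diagMap r s (0, 1) = s • (0, 1) by simp [diagMap_apply], map_smul, Prod.smul_fst,
      smul_eq_mul, diagMap_apply, mul_eq_mul_right_iff] at h
    exact h.resolve_left hrs.symm
  refine ⟨(A (1, 0)).1, (A (0, 1)).2, LinearMap.ext fun z => ?_⟩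
  have hz : z = z.1 • (1, 0) + z.2 • (0, 1) := by ext <;> simp
  rw [hz, map_add, map_smul, map_smul]
  ext <;> simp [diagMap_apply, hx, hy, mul_comm]

end DiagMap

section BiFanMap

variable {L : Submodule ℤ Plane} {b : Plane × Plane} {α β : ℝ}

lemma diagPair_mem_biFan (hb : b ∈ biFan L) (hα : 0 < α) (hβ : 0 < β) :
    diagPair α β b ∈ biFan (L.map ((diagMap α β).restrictScalars ℤ)) := by
  obtain ⟨he1, he2, hf1, hf2, hspan⟩ := hb
  refine ⟨mul_pos hα he1, mul_pos hβ he2, mul_neg_of_pos_of_neg hα hf1, mul_pos hβ hf2, ?_⟩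
  rw [← hspan, Submodule.map_span, image_pair]
  rfl

lemma mirror_mem_biFan (hb : b ∈ biFan L) :
    mirror b ∈ biFan (L.map ((diagMap (-1) 1).restrictScalars ℤ)) := by
  obtain ⟨he1, he2, hf1, hf2, hspan⟩ := hb
  refine ⟨mul_pos_of_neg_of_neg neg_one_lt_zero hf1, mul_pos one_pos hf2,
    mul_neg_of_neg_of_pos neg_one_lt_zero he1, mul_pos one_pos he2, ?_⟩
  rw [← hspan, Submodule.map_span, image_pair, pair_comm]
  rfl

lemma AxisFree.map_diagMap (hL : AxisFree L) (hα : α ≠ 0) (hβ : β ≠ 0) :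
    AxisFree (L.map ((diagMap α β).restrictScalars ℤ)) where
  eq_zero_of_fst := by
    rintro _ ⟨l, hl, rfl⟩ h
    rw [hL.eq_zero_of_fst l hl ((mul_eq_zero.1 h).resolve_left hα), map_zero]
  eq_zero_of_snd := by
    rintro _ ⟨l, hl, rfl⟩ h
    rw [hL.eq_zero_of_snd l hl ((mul_eq_zero.1 h).resolve_left hβ), map_zero]

lemma exists_basis_of_mem_biFan (hb : b ∈ biFan L) :
    ∃ B : Module.Basis (Fin 2) ℝ Plane, B 0 = b.1 ∧ B 1 = b.2 := by
  have hli : LinearIndependent ℝ ![b.1, b.2] := by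
    refine LinearIndependent.pair_iff.2 fun s t h => ?_
    have h1 : s * b.1.1 + t * b.2.1 = 0 := congrArg Prod.fst h
    have h2 : s * b.1.2 + t * b.2.2 = 0 := congrArg Prod.snd h
    have hdet := (det_pos_of_mem_biFan hb).ne'
    exact ⟨(mul_eq_zero.1 (by linear_combination b.2.2 * h1 - b.2.1 * h2)).resolve_right hdet,
      (mul_eq_zero.1 (by linear_combination b.1.1 * h2 - b.1.2 * h1)).resolve_right hdet⟩
  exact ⟨basisOfLinearIndependentOfCardEqFinrank hli (by simp), by simp, by simp⟩

end BiFanMap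

section CutMap

variable {L : Submodule ℤ Plane} {b : Plane × Plane} {α β : ℝ}

lemma cutForward_diagPair (hα : 0 < α) (b : Plane × Plane) :
    cutForward (diagPair α β b) = diagPair α β (cutForward b) := by
  have hiff : 0 < (diagMap α β b.1 + diagMap α β b.2).1 ↔ 0 < (b.1 + b.2).1 := by
    rw [← map_add]
    exact mul_pos_iff_of_pos_left hα
  by_cases h : 0 < (b.1 + b.2).1
  · rw [cutForward_of_pos h, cutForward_of_pos (hiff.2 h), diagPair, diagPair, map_add]
  · rw [cutForward_of_not_pos h, cutForward_of_not_pos (mt hiff.1 h), diagPair, diagPair, map_add]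

lemma cutBackward_diagPair (hβ : 0 < β) (b : Plane × Plane) :
    cutBackward (diagPair α β b) = diagPair α β (cutBackward b) := by
  have hiff : 0 < (diagMap α β b.1 - diagMap α β b.2).2 ↔ 0 < (b.1 - b.2).2 := by
    rw [← map_sub]
    exact mul_pos_iff_of_pos_left hβ
  by_cases h : 0 < (b.1 - b.2).2
  · rw [cutBackward_of_pos h, cutBackward_of_pos (hiff.2 h), diagPair, diagPair, map_sub]
  · rw [cutBackward_of_not_pos h, cutBackward_of_not_pos (mt hiff.1 h), diagPair, diagPair, map_sub]

lemma cutForward_mirror (hL : AxisFree L) (hb : b ∈ biFan L) :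
    cutForward (mirror b) = mirror (cutForward b) := by
  have hne := fst_add_ne_zero_of_mem_biFan hL hb
  have hfst : (diagMap (-1) 1 b.2 + diagMap (-1) 1 b.1).1 = -(b.1 + b.2).1 := by
    rw [← map_add, add_comm, diagMap_apply, neg_one_mul]
  by_cases h : 0 < (b.1 + b.2).1
  · rw [cutForward_of_pos h, cutForward_of_not_pos (by rw [mirror, hfst]; linarith), mirror, mirror,
      map_add, add_comm]
  · have hlt := lt_of_le_of_ne (not_lt.1 h) hne
    rw [cutForward_of_not_pos h, cutForward_of_pos (by rw [mirror, hfst]; linarith), mirror, mirror,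
      map_add, add_comm]

lemma cutBackward_mirror (hL : AxisFree L) (hb : b ∈ biFan L) :
    cutBackward (mirror b) = mirror (cutBackward b) := by
  have hne := snd_sub_ne_zero_of_mem_biFan hL hb
  have hsnd : (diagMap (-1) 1 b.2 - diagMap (-1) 1 b.1).2 = -(b.1 - b.2).2 := by
    rw [← map_sub, ← neg_sub b.1, map_neg, Prod.snd_neg, diagMap_apply, one_mul]
  by_cases h : 0 < (b.1 - b.2).2
  · rw [cutBackward_of_pos h, cutBackward_of_not_pos (by rw [mirror, hsnd]; linarith), mirror,
      mirror, map_sub]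
  · have hlt := lt_of_le_of_ne (not_lt.1 h) hne
    rw [cutBackward_of_not_pos h, cutBackward_of_pos (by rw [mirror, hsnd]; linarith), mirror,
      mirror, map_sub]

lemma cutBasis_apply_of_commute (hL : AxisFree L) (hb : b ∈ biFan L)
    {T : Plane × Plane → Plane × Plane}
    (hfwd : ∀ c ∈ biFan L, cutForward (T c) = T (cutForward c))
    (hback : ∀ c ∈ biFan L, cutBackward (T c) = T (cutBackward c)) (n : ℤ) :
    cutBasis (T b) n = T (cutBasis b n) := by
  have iterate_apply {g : Plane × Plane → Plane × Plane} (hg : ∀ c ∈ biFan L, g (T c) = T (g c))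
      (hmem : ∀ n, g^[n] b ∈ biFan L) (n : ℕ) : g^[n] (T b) = T (g^[n] b) := by
    induction n with
    | zero => rfl
    | succ n ih => rw [Function.iterate_succ_apply', ih, hg _ (hmem n),
        Function.iterate_succ_apply']
  cases n with
  | ofNat n => exact iterate_apply hfwd (iterate_cutForward_mem_biFan hL hb) n
  | negSucc n => exact iterate_apply hback (iterate_cutBackward_mem_biFan hL hb) (n + 1)

lemma cutBasis_diagPair (hL : AxisFree L) (hb : b ∈ biFan L) (hα : 0 < α) (hβ : 0 < β) (n : ℤ) :
    cutBasis (diagPair α β b) n = diagPair α β (cutBasis b n) :=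
  cutBasis_apply_of_commute hL hb (fun c _ => cutForward_diagPair hα c)
    (fun c _ => cutBackward_diagPair hβ c) n

lemma cutBasis_mirror (hL : AxisFree L) (hb : b ∈ biFan L) (n : ℤ) :
    cutBasis (mirror b) n = mirror (cutBasis b n) :=
  cutBasis_apply_of_commute hL hb (fun _ => cutForward_mirror hL) (fun _ => cutBackward_mirror hL) n

lemma cutBasis_cutBasis (hL : AxisFree L) (hb : b ∈ biFan L) (m n : ℤ) :
    cutBasis (cutBasis b m) n = cutBasis b (m + n) := by
  have hm := cutBasis_mem_biFan hL hb m
  induction n with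
  | zero => rw [add_zero]; rfl
  | succ n ih => rw [cutBasis_add_one hL hm, ih, ← add_assoc, cutBasis_add_one hL hb]
  | pred n ih => rw [cutBasis_sub_one hL hm, ih, ← add_sub_assoc, cutBasis_sub_one hL hb]

lemma cuttingSeq_cutBasis (hL : AxisFree L) (hb : b ∈ biFan L) (m n : ℤ) :
    cuttingSeq (cutBasis b m) n = cuttingSeq b (m + n) := by
  rw [cuttingSeq, cuttingSeq, cutBasis_cutBasis hL hb, cutBasis_cutBasis hL hb, add_assoc]

lemma cuttingSeq_diagPair (hL : AxisFree L) (hb : b ∈ biFan L) (hα : 0 < α) (hβ : 0 < β) :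
    cuttingSeq (diagPair α β b) = cuttingSeq b := by
  funext n
  rw [cuttingSeq, cuttingSeq, cutBasis_diagPair hL hb hα hβ, cutBasis_diagPair hL hb hα hβ]
  simp only [diagPair, (diagMap_injective hα.ne' hβ.ne').eq_iff]

lemma cuttingSeq_mirror (hL : AxisFree L) (hb : b ∈ biFan L) (n : ℤ) :
    cuttingSeq (mirror b) n = 1 - cuttingSeq b n := by
  have hbn := cutBasis_mem_biFan hL hb n
  rw [cuttingSeq, cuttingSeq, cutBasis_mirror hL hb, cutBasis_mirror hL hb, cutBasis_add_one hL hb]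
  simp only [mirror, (diagMap_injective (neg_ne_zero.2 one_ne_zero) one_ne_zero).eq_iff]
  have he : (cutBasis b n).1 ≠ 0 := fun h => hbn.1.ne' (congrArg Prod.fst h)
  have hf : (cutBasis b n).2 ≠ 0 := fun h => hbn.2.2.1.ne (congrArg Prod.fst h)
  by_cases h : 0 < ((cutBasis b n).1 + (cutBasis b n).2).1
  · simp [cutForward_of_pos h, hf]
  · simp [cutForward_of_not_pos h, he]

lemma cutBasis_add_one_eq_ite (hL : AxisFree L) (hb : b ∈ biFan L) (n : ℤ) :
    cutBasis b (n + 1) = if cuttingSeq b n = 1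
      then ((cutBasis b n).1 + (cutBasis b n).2, (cutBasis b n).2)
      else ((cutBasis b n).1, (cutBasis b n).1 + (cutBasis b n).2) := by
  classical
  rw [cutBasis_add_one hL hb, cuttingSeq_eq_ite hL hb, cutForward]
  split_ifs <;> simp_all

end CutMap

section Rigidity

variable {L L' : Submodule ℤ Plane} {b b' : Plane × Plane}

lemma cutBasis_eq_map_of_cuttingSeq_eq (hL : AxisFree L) (hL' : AxisFree L') (hb : b ∈ biFan L)
    (hb' : b' ∈ biFan L') (hs : cuttingSeq b = cuttingSeq b') {A : Plane →ₗ[ℝ] Plane}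
    (hA : b' = (A b.1, A b.2)) (n : ℤ) :
    cutBasis b' n = (A (cutBasis b n).1, A (cutBasis b n).2) := by
  induction n with
  | zero => exact hA
  | succ n ih =>
    rw [cutBasis_add_one_eq_ite hL' hb', cutBasis_add_one_eq_ite hL hb, ← hs, ih]
    split_ifs <;> simp only [map_add]
  | pred n ih =>
    have h := cutBasis_add_one_eq_ite hL hb (-n - 1)
    have h' := cutBasis_add_one_eq_ite hL' hb' (-n - 1)
    rw [sub_add_cancel] at h h'
    rw [h', ← hs, h] at ih
    split_ifs at ih <;> simp only [Prod.mk.injEq, map_add] at ih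
    · exact Prod.ext (add_right_cancel (ih.1.trans (by rw [ih.2]))) ih.2
    · exact Prod.ext ih.1 (add_left_cancel (ih.2.trans (by rw [ih.1])))

/-- The linear map taking `b` into `b'` takes all of the bases `cutBasis b n` into those of `b'`,
hence commutes with `diag(r, s)`. -/
theorem exists_eq_diagPair_of_cuttingSeq_eq (hL : AxisFree L) (hL' : AxisFree L')
    (hb : b ∈ biFan L) (hb' : b' ∈ biFan L') (hs : cuttingSeq b = cuttingSeq b') {r s : ℝ}
    (hrs : r ≠ s) {K : ℤ} (hK : cutBasis b K = diagPair r s b)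
    (hK' : cutBasis b' K = diagPair r s b') :
    ∃ α β : ℝ, 0 < α ∧ 0 < β ∧ b' = diagPair α β b := by
  obtain ⟨B, hB0, hB1⟩ := exists_basis_of_mem_biFan hb
  let A : Plane →ₗ[ℝ] Plane := B.constr ℝ ![b'.1, b'.2]
  have hA1 : A b.1 = b'.1 := by simp [A, ← hB0]
  have hA2 : A b.2 = b'.2 := by simp [A, ← hB1]
  have hAK := cutBasis_eq_map_of_cuttingSeq_eq hL hL' hb hb' hs (A := A)
    (Prod.ext hA1.symm hA2.symm) K
  rw [hK, hK', Prod.ext_iff] at hAK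
  obtain ⟨α, β, hαβ⟩ := exists_eq_diagMap_of_commute hrs (A := A) <| B.ext fun i => by
    fin_cases i
    · simpa [diagPair, hB0, hA1] using hAK.1.symm
    · simpa [diagPair, hB1, hA2] using hAK.2.symm
  rw [hαβ] at hA1 hA2
  have he := hb'.1
  have he' := hb'.2.1
  rw [← hA1] at he he'
  exact ⟨α, β, pos_of_mul_pos_left he hb.1.le, pos_of_mul_pos_left he' hb.2.1.le,
    Prod.ext hA1.symm hA2.symm⟩

end Rigidity

section Shift

variable {L : Submodule ℤ Plane} {b b' : Plane × Plane}

lemma HyperbolicToralAut.map_diagMap_sq (D : HyperbolicToralAut L) :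
    L.map ((diagMap (D.mu ^ 2) (D.lam ^ 2)).restrictScalars ℤ) = L := by
  have hsq (z : Plane) : diagMap (D.mu ^ 2) (D.lam ^ 2) z = D.planeMap (D.planeMap z) := by
    simp only [diagMap_apply, D.planeMap_apply, sq, mul_assoc]
  refine le_antisymm ?_ fun z hz => ?_
  · rintro _ ⟨z, hz, rfl⟩
    rw [LinearMap.restrictScalars_apply, hsq]
    exact D.planeMap_mem_iff.2 (D.planeMap_mem_iff.2 hz)
  · obtain ⟨w, rfl⟩ := D.planeMap_surjective z
    obtain ⟨w, rfl⟩ := D.planeMap_surjective w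
    exact ⟨w, D.planeMap_mem_iff.1 (D.planeMap_mem_iff.1 hz), hsq w⟩

lemma HyperbolicToralAut.exists_cutBasis_eq_diagPair_sq (D : HyperbolicToralAut L)
    (hL : AxisFree L) (hb : b ∈ biFan L) :
    ∃ K : ℤ, K ≠ 0 ∧ ∀ b' ∈ biFan L, cutBasis b' K = diagPair (D.mu ^ 2) (D.lam ^ 2) b' := by
  have hmu : 0 < D.mu ^ 2 := sq_pos_of_ne_zero D.mu_ne_zero
  have hlam : 0 < D.lam ^ 2 := sq_pos_of_ne_zero D.lam_ne_zero
  have hDb : diagPair (D.mu ^ 2) (D.lam ^ 2) b ∈ biFan L := by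
    simpa only [D.map_diagMap_sq] using diagPair_mem_biFan hb hmu hlam
  obtain ⟨K, hK⟩ := exists_eq_cutBasis hL hb hDb
  refine ⟨K, ?_, fun b' hb' => ?_⟩
  · rintro rfl
    have h1 : D.lam ^ 2 * b.1.2 = b.1.2 := congrArg (fun b => b.1.2) hK
    exact (one_lt_sq_iff_one_lt_abs _).2 D.one_lt_abs_lam |>.ne' ((mul_eq_right₀ hb.2.1.ne').1 h1)
  · obtain ⟨n, rfl⟩ := exists_eq_cutBasis hL hb hb'
    rw [cutBasis_cutBasis hL hb, add_comm, ← cutBasis_cutBasis hL hb, ← hK,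
      cutBasis_diagPair hL hb hmu hlam]

theorem diagRel_iff_cuttingSeq (D : HyperbolicToralAut L) (hL : AxisFree L) (hb : b ∈ biFan L)
    (hb' : b' ∈ biFan L) : DiagRel b b' ↔
      (∀ n, cuttingSeq b' n = cuttingSeq b n) ∨ ∀ n, cuttingSeq b' n = 1 - cuttingSeq b n := by
  have hLm : AxisFree (L.map ((diagMap (-1) 1).restrictScalars ℤ)) :=
    hL.map_diagMap (neg_ne_zero.2 one_ne_zero) one_ne_zero
  have hbm := mirror_mem_biFan hb
  constructor
  · rintro ⟨α, β, hα, hβ, rfl | rfl⟩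
    · exact .inl fun n => by rw [cuttingSeq_diagPair hL hb hα hβ]
    · exact .inr fun n => by rw [cuttingSeq_diagPair hLm hbm hα hβ, cuttingSeq_mirror hL hb]
  · obtain ⟨K, -, hK⟩ := D.exists_cutBasis_eq_diagPair_sq hL hb
    have hne : D.mu ^ 2 ≠ D.lam ^ 2 :=
      (sq_lt_sq.2 (D.abs_mu_lt_one.trans D.one_lt_abs_lam)).ne
    rintro (hs | hs)
    · obtain ⟨α, β, hα, hβ, h⟩ := exists_eq_diagPair_of_cuttingSeq_eq hL hL hb hb'
        (funext fun n => (hs n).symm) hne (hK b hb) (hK b' hb')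
      exact ⟨α, β, hα, hβ, .inl h⟩
    · have hKm : cutBasis (mirror b) K = diagPair (D.mu ^ 2) (D.lam ^ 2) (mirror b) := by
        rw [cutBasis_mirror hL hb, hK b hb, diagPair_mirror]
      obtain ⟨α, β, hα, hβ, h⟩ := exists_eq_diagPair_of_cuttingSeq_eq hLm hL hbm hb'
        (funext fun n => by rw [cuttingSeq_mirror hL hb, hs]) hne hKm (hK b' hb')
      exact ⟨α, β, hα, hβ, .inr h⟩

end Shift

/-! ### Periods and semi-periods -/

/-- The shifts that preserve the sequence `s` or take it into `1 - s`. -/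
def shiftGroup (s : ℤ → ℤ) : AddSubgroup ℤ where
  carrier := {d | (∀ k, s (k + d) = s k) ∨ ∀ k, s (k + d) = 1 - s k}
  zero_mem' := .inl (by simp)
  add_mem' := by
    rintro c d (hc | hc) (hd | hd)
    · exact .inl fun k => by rw [← add_assoc, hd, hc]
    · exact .inr fun k => by rw [← add_assoc, hd, hc]
    · exact .inr fun k => by rw [← add_assoc, hd, hc]
    · exact .inl fun k => by rw [← add_assoc, hd, hc, sub_sub_cancel]
  neg_mem' := by
    rintro d (hd | hd)
    · exact .inl fun k => by rw [← hd (k + -d), neg_add_cancel_right]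
    · exact .inr fun k => by rw [← sub_sub_cancel 1 (s (k + -d)), ← hd, neg_add_cancel_right]

section ShiftGroup

variable {s : ℤ → ℤ} {N : ℕ}

lemma mem_shiftGroup {d : ℤ} :
    d ∈ shiftGroup s ↔ (∀ k, s (k + d) = s k) ∨ ∀ k, s (k + d) = 1 - s k :=
  Iff.rfl

/-- A period `d` shorter than the smallest semi-period `N` would make `N - d` a semi-period. -/
lemma IsBasicSemiPeriodOrPeriod.isLeast_shiftGroup (h : IsBasicSemiPeriodOrPeriod s N) :
    IsLeast {d : ℤ | d ∈ shiftGroup s ∧ 0 < d} N := by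
  have hN : (N : ℤ) ∈ shiftGroup s ∧ 0 < N :=
    h.elim (fun h => ⟨.inr h.1.2, h.1.1⟩) fun h => ⟨.inl h.2.1.2, h.2.1.1⟩
  refine ⟨⟨hN.1, Int.natCast_pos.2 hN.2⟩, ?_⟩
  rintro d ⟨hd, hd0⟩
  lift d to ℕ using hd0.le
  rw [Int.natCast_pos] at hd0
  rw [Nat.cast_le]
  rcases hd, h with ⟨hper | hsemi, h | h⟩
  · by_contra! hlt
    have hsub : IsSemiPeriod s (N - d) := by
      refine ⟨Nat.sub_pos_of_lt hlt, fun k => ?_⟩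
      rw [← h.1.2 k, ← hper, Nat.cast_sub hlt.le, add_assoc, sub_add_cancel]
    have := h.2 hsub
    omega
  · exact h.2.2 ⟨hd0, hper⟩
  · exact h.2 ⟨hd0, hsemi⟩
  · exact absurd ⟨d, hd0, hsemi⟩ h.1

lemma IsBasicSemiPeriodOrPeriod.existsUnique_sub_mem_shiftGroup
    (h : IsBasicSemiPeriodOrPeriod s N) (n : ℤ) :
    ∃! i : Fin N, n - (i : ℕ) ∈ shiftGroup s := by
  have hleast := h.isLeast_shiftGroup
  have hN : (0 : ℤ) < N := hleast.1.2
  have hmod (i : Fin N) : n - (i : ℕ) ∈ shiftGroup s ↔ ((i : ℕ) : ℤ) = n % N := by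
    rw [AddSubgroup.cyclic_of_min hleast, ← AddSubgroup.zmultiples_eq_closure,
      Int.mem_zmultiples_iff, ← Int.modEq_iff_dvd, Int.ModEq,
      Int.emod_eq_of_lt (Int.natCast_nonneg _) (Nat.cast_lt.2 i.2)]
  simp only [hmod]
  have h0 := Int.emod_nonneg n hN.ne'
  have h1 := Int.emod_lt_of_pos n hN
  exact ⟨⟨(n % N).toNat, by omega⟩, Int.toNat_of_nonneg h0, fun i hi => Fin.ext (by simp [← hi])⟩

lemma exists_isBasicSemiPeriodOrPeriod_of_isPeriod (hN : IsPeriod s N) :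
    ∃ N, IsBasicSemiPeriodOrPeriod s N := by
  by_cases hsemi : ∃ M, IsSemiPeriod s M
  · exact ⟨sInf {M | IsSemiPeriod s M}, .inl (isLeast_csInf hsemi)⟩
  · exact ⟨sInf {M | IsPeriod s M}, .inr ⟨hsemi, isLeast_csInf ⟨N, hN⟩⟩⟩

end ShiftGroup

section CuttingPeriod

variable {L : Submodule ℤ Plane} {b : Plane × Plane}

lemma exists_isPeriod_cuttingSeq (D : HyperbolicToralAut L) (hL : AxisFree L) (hb : b ∈ biFan L) :
    ∃ N, IsPeriod (cuttingSeq b) N := by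
  obtain ⟨K, hK0, hK⟩ := D.exists_cutBasis_eq_diagPair_sq hL hb
  have hper (k : ℤ) : cuttingSeq b (k + K) = cuttingSeq b k := by
    rw [add_comm, ← cuttingSeq_cutBasis hL hb, hK b hb, cuttingSeq_diagPair hL hb
      (sq_pos_of_ne_zero D.mu_ne_zero) (sq_pos_of_ne_zero D.lam_ne_zero)]
  refine ⟨K.natAbs, Int.natAbs_pos.2 hK0, fun k => ?_⟩
  rcases Int.natAbs_eq K with h | h
  · rw [← h, hper]
  · rw [← hper, show (K.natAbs : ℤ) = -K by omega, neg_add_cancel_right]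

theorem exists_isBasicSemiPeriodOrPeriod (D : HyperbolicToralAut L) (hL : AxisFree L)
    (hb : b ∈ biFan L) : ∃ N, IsBasicSemiPeriodOrPeriod (cuttingSeq b) N :=
  have ⟨_, hN⟩ := exists_isPeriod_cuttingSeq D hL hb
  exists_isBasicSemiPeriodOrPeriod_of_isPeriod hN

theorem diagRel_cutBasis_iff (D : HyperbolicToralAut L) (hL : AxisFree L) (hb : b ∈ biFan L)
    (m n : ℤ) : DiagRel (cutBasis b m) (cutBasis b n) ↔ n - m ∈ shiftGroup (cuttingSeq b) := by
  rw [diagRel_iff_cuttingSeq D hL (cutBasis_mem_biFan hL hb m) (cutBasis_mem_biFan hL hb n),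
    mem_shiftGroup]
  simp only [cuttingSeq_cutBasis hL hb]
  have reindex (g : ℤ → ℤ) : (∀ k, cuttingSeq b (n + k) = g (m + k)) ↔
      ∀ k, cuttingSeq b (k + (n - m)) = g k :=
    ⟨fun h k => by simpa [add_comm, add_left_comm, sub_eq_add_neg] using h (k - m),
      fun h k => by rw [← h, show m + k + (n - m) = n + k by ring]⟩
  exact or_congr (reindex _) (reindex fun k => 1 - cuttingSeq b k)

end CuttingPeriod

/-! ### Bi-partitions tile the torus -/

namespace BiPartition

variable {L : Submodule ℤ Plane} (P : BiPartition L)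

/-- The basis `([v, p], [-u, q])` of the bi-fan that belongs to a bi-partition. -/
def basis : Plane × Plane := ((P.v, P.p), (-P.u, P.q))

lemma basis_mem : P.basis ∈ biFan L :=
  ⟨P.v_pos, P.p_pos, neg_neg_of_pos P.u_pos, P.q_pos, P.span_eq⟩

/-- The widths of the two rectangles. -/
def width : Fin 2 → ℝ := ![P.u, P.v]

/-- The heights of the two rectangles. -/
def height : Fin 2 → ℝ := ![P.p, P.q]

@[simp] lemma left_zero : P.left 0 = P.w.1 := rfl
@[simp] lemma left_one : P.left 1 = P.w.1 - P.v := rfl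
@[simp] lemma right_zero : P.right 0 = P.w.1 + P.u := rfl
@[simp] lemma right_one : P.right 1 = P.w.1 := rfl
@[simp] lemma bottom_eq (i : Fin 2) : P.bottom i = P.w.2 := by fin_cases i <;> rfl
@[simp] lemma top_zero : P.top 0 = P.w.2 + P.p := rfl
@[simp] lemma top_one : P.top 1 = P.w.2 + P.q := rfl
@[simp] lemma width_zero : P.width 0 = P.u := rfl
@[simp] lemma width_one : P.width 1 = P.v := rfl
@[simp] lemma height_zero : P.height 0 = P.p := rfl
@[simp] lemma height_one : P.height 1 = P.q := rfl

lemma width_pos : ∀ i, 0 < P.width i := Fin.forall_fin_two.2 ⟨P.u_pos, P.v_pos⟩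

lemma height_pos : ∀ i, 0 < P.height i := Fin.forall_fin_two.2 ⟨P.p_pos, P.q_pos⟩

lemma right_sub_left : ∀ i, P.right i - P.left i = P.width i := by
  simp [Fin.forall_fin_two]

lemma top_sub_bottom : ∀ i, P.top i - P.bottom i = P.height i := by
  simp [Fin.forall_fin_two]

lemma left_lt_right (i : Fin 2) : P.left i < P.right i := by
  linarith [P.width_pos i, P.right_sub_left i]

lemma bottom_lt_top (i : Fin 2) : P.bottom i < P.top i := by
  linarith [P.height_pos i, P.top_sub_bottom i]

lemma interior_rect (i : Fin 2) :
    interior (P.rect i) = Ioo (P.left i) (P.right i) ×ˢ Ioo (P.bottom i) (P.top i) := by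
  rw [rect, interior_prod_eq, interior_Icc, interior_Icc]

/-- The segment formed by the two bottom sides. It projects onto the horizontal spine, since the
top sides are translates of parts of it. -/
def hSegment : Set Plane := Icc (P.w.1 - P.v) (P.w.1 + P.u) ×ˢ {P.w.2}

/-- The segment of length `p + q` going up from the common corner. It projects onto the vertical
spine, since the four vertical sides are translates of parts of it. -/
def vSegment : Set Plane := {P.w.1} ×ˢ Icc P.w.2 (P.w.2 + (P.p + P.q))

lemma mkQ_mem_image {z l : Plane} {S : Set Plane} (hl : l ∈ L) (h : z + l ∈ S) :
    L.mkQ z ∈ L.mkQ '' S :=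
  ⟨z + l, h, mkQ_add_of_mem z hl⟩

lemma horizontalSpine_eq : P.horizontalSpine = L.mkQ '' P.hSegment := by
  have hu := P.u_pos
  have hv := P.v_pos
  have he := fst_mem_of_mem_biFan P.basis_mem
  have hf := snd_mem_of_mem_biFan P.basis_mem
  apply Subset.antisymm
  · rintro _ ⟨⟨x, y⟩, hz, rfl⟩
    simp only [mem_iUnion, Fin.exists_fin_two, mem_prod, mem_Icc, mem_insert_iff,
      mem_singleton_iff, left_zero, left_one, right_zero, right_one, bottom_eq, top_zero,
      top_one] at hz
    obtain ⟨hx, rfl | rfl⟩ | ⟨hx, rfl | rfl⟩ := hz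
    · exact mem_image_of_mem _ ⟨⟨by linarith, by linarith⟩, rfl⟩
    · refine mkQ_mem_image (L.neg_mem he) ⟨⟨?_, ?_⟩, ?_⟩ <;>
        simp only [basis, Prod.neg_mk, Prod.mk_add_mk, mem_singleton_iff] <;> linarith
    · exact mem_image_of_mem _ ⟨⟨by linarith, by linarith⟩, rfl⟩
    · refine mkQ_mem_image (L.neg_mem hf) ⟨⟨?_, ?_⟩, ?_⟩ <;>
        simp only [basis, Prod.neg_mk, Prod.mk_add_mk, mem_singleton_iff] <;> linarith
  · refine image_mono fun z hz => mem_iUnion.2 ?_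
    obtain ⟨⟨h1, h2⟩, h3⟩ := hz
    rcases le_total P.w.1 z.1 with h | h
    · exact ⟨0, ⟨h, h2⟩, Or.inl h3⟩
    · exact ⟨1, ⟨h1, h⟩, Or.inl h3⟩

lemma verticalSpine_eq : P.verticalSpine = L.mkQ '' P.vSegment := by
  have hp := P.p_pos
  have hq := P.q_pos
  have he := fst_mem_of_mem_biFan P.basis_mem
  have hf := snd_mem_of_mem_biFan P.basis_mem
  apply Subset.antisymm
  · rintro _ ⟨⟨x, y⟩, hz, rfl⟩
    simp only [mem_iUnion, Fin.exists_fin_two, mem_prod, mem_Icc, mem_insert_iff,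
      mem_singleton_iff, left_zero, left_one, right_zero, right_one, bottom_eq, top_zero,
      top_one] at hz
    obtain ⟨rfl | rfl, hy⟩ | ⟨rfl | rfl, hy⟩ := hz
    · exact mem_image_of_mem _ ⟨rfl, by linarith, by linarith⟩
    · refine mkQ_mem_image hf ⟨?_, ?_, ?_⟩ <;>
        simp only [basis, Prod.mk_add_mk, mem_singleton_iff] <;> linarith
    · refine mkQ_mem_image he ⟨?_, ?_, ?_⟩ <;>
        simp only [basis, Prod.mk_add_mk, mem_singleton_iff] <;> linarith
    · exact mem_image_of_mem _ ⟨rfl, by linarith, by linarith⟩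
  · rintro _ ⟨⟨x, y⟩, ⟨rfl, h1, h2⟩, rfl⟩
    rcases le_total y (P.w.2 + P.q) with h | h
    · exact mem_image_of_mem _ (mem_iUnion.2 ⟨1, Or.inr rfl, h1, h⟩)
    · refine mkQ_mem_image (L.neg_mem hf) (mem_iUnion.2 ⟨0, Or.inr ?_, ?_, ?_⟩) <;>
        simp only [basis, Prod.neg_mk, Prod.mk_add_mk, neg_neg, mem_singleton_iff, right_zero,
          bottom_eq, top_zero] at h2 ⊢ <;> linarith

lemma eq_zero_or_long_of_mem {l : Plane} (hl : l ∈ L) :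
    l = 0 ∨ P.u + P.v ≤ |l.1| ∨ P.p + P.q ≤ |l.2| ∨
      (P.v ≤ l.1 ∧ P.p ≤ l.2) ∨ (l.1 ≤ -P.v ∧ l.2 ≤ -P.p) ∨
      (l.1 ≤ -P.u ∧ P.q ≤ l.2) ∨ (P.u ≤ l.1 ∧ l.2 ≤ -P.q) := by
  obtain ⟨m, n, h1, h2⟩ := (mem_iff_of_mem_biFan P.basis_mem).1 hl
  simp only [basis] at h1 h2
  have hu := P.u_pos
  have hv := P.v_pos
  have hp := P.p_pos
  have hq := P.q_pos
  have trichotomy (k : ℤ) : (k : ℝ) ≤ -1 ∨ (k : ℝ) = 0 ∨ 1 ≤ (k : ℝ) := by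
    have : k ≤ -1 ∨ k = 0 ∨ 1 ≤ k := by omega
    exact_mod_cast this
  rw [le_abs, le_abs]
  obtain hm | hm | hm := trichotomy m <;> obtain hn | hn | hn := trichotomy n
  · right; right; left; right; nlinarith
  · rw [hn] at h1 h2
    right; right; right; right; left; constructor <;> nlinarith
  · right; left; right; nlinarith
  · rw [hm] at h1 h2
    right; right; right; right; right; right; constructor <;> nlinarith
  · left; ext <;> simp [h1, h2, hm, hn]
  · rw [hm] at h1 h2
    right; right; right; right; right; left; constructor <;> nlinarith
  · right; left; left; nlinarith
  · rw [hn] at h1 h2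
    right; right; right; left; constructor <;> nlinarith
  · right; right; left; left; nlinarith

/-- The half-open rectangles: their translates by `L` tile the plane. -/
def halfOpen (i : Fin 2) : Set Plane := Ico (P.left i) (P.right i) ×ˢ Ico (P.bottom i) (P.top i)

lemma interior_rect_subset_halfOpen (i : Fin 2) : interior (P.rect i) ⊆ P.halfOpen i := by
  rw [interior_rect]
  exact prod_mono Ioo_subset_Ico_self Ioo_subset_Ico_self

lemma halfOpen_unique {i j : Fin 2} {z l l' : Plane} (hl : l ∈ L) (hl' : l' ∈ L)
    (h : z - l ∈ P.halfOpen i) (h' : z - l' ∈ P.halfOpen j) : i = j ∧ l = l' := by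
  have hlong := P.eq_zero_or_long_of_mem (L.sub_mem hl hl')
  rw [sub_eq_zero, le_abs, le_abs] at hlong
  obtain ⟨⟨h1, h2⟩, h3, h4⟩ := h
  obtain ⟨⟨h1', h2'⟩, h3', h4'⟩ := h'
  have hu := P.u_pos
  have hv := P.v_pos
  have hp := P.p_pos
  have hq := P.q_pos
  fin_cases i <;> fin_cases j <;>
    simp only [Fin.zero_eta, Fin.mk_one, left_zero, left_one, right_zero, right_one, bottom_eq,
      top_zero, top_one, Prod.fst_sub, Prod.snd_sub] at h1 h2 h3 h4 h1' h2' h3' h4' hlong <;>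
    obtain rfl | (h | h) | (h | h) | h | h | h | h := hlong <;>
    first | exact ⟨rfl, rfl⟩ | exfalso; linarith

lemma exists_add_mem_strip (z : Plane) :
    ∃ l ∈ L, -P.v ≤ (z + l).1 ∧ (z + l).1 < P.u ∧ 0 ≤ (z + l).2 := by
  have hu := P.u_pos
  have hv := P.v_pos
  obtain ⟨n, hn1, hn2⟩ : ∃ n : ℕ, z.1 ≤ n * P.u ∧ -z.2 ≤ n * P.q := by
    obtain ⟨n, hn⟩ := exists_nat_ge (max (z.1 / P.u) (-z.2 / P.q))
    rw [max_le_iff, div_le_iff₀ hu, div_le_iff₀ P.q_pos] at hn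
    exact ⟨n, hn⟩
  set m := ⌊(n * P.u - z.1) / P.v⌋
  have hm0 : (0 : ℝ) ≤ m := by
    exact_mod_cast Int.floor_nonneg.2 (div_nonneg (sub_nonneg.2 hn1) hv.le)
  have hm1 : m * P.v ≤ n * P.u - z.1 := (le_div_iff₀ hv).1 (Int.floor_le _)
  have hm2 : n * P.u - z.1 < (m + 1) * P.v := (div_lt_iff₀ hv).1 (Int.lt_floor_add_one _)
  refine ⟨(m * P.v - n * P.u, m * P.p + n * P.q),
    (mem_iff_of_mem_biFan P.basis_mem).2 ⟨m, n, ?_, ?_⟩, ?_, ?_, ?_⟩ <;>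
    simp only [basis, Prod.fst_add, Prod.snd_add, Int.cast_natCast]
  · ring
  · linarith
  · linarith
  · linarith [mul_nonneg hm0 P.p_pos.le]

lemma exists_sub_mem_halfOpen_of_mem_strip (n : ℕ) {z : Plane} (h1 : -P.v ≤ z.1) (h2 : z.1 < P.u)
    (h3 : 0 ≤ z.2) (hn : z.2 < n * min P.p P.q) :
    ∃ i, ∃ l ∈ L, P.w + z - l ∈ P.halfOpen i := by
  have hu := P.u_pos
  have hv := P.v_pos
  have hp := min_le_left P.p P.q
  have hq := min_le_right P.p P.q
  -- What lies above `R₁` (above `R₂`) is moved down within the strip by subtracting `[v, p]`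
  -- (by subtracting `[-u, q]`).
  have step {z l : Plane} (hl : l ∈ L) (h : ∃ i, ∃ l' ∈ L, P.w + (z - l) - l' ∈ P.halfOpen i) :
      ∃ i, ∃ l' ∈ L, P.w + z - l' ∈ P.halfOpen i := by
    obtain ⟨i, l', hl', h⟩ := h
    exact ⟨i, l + l', L.add_mem hl hl', by convert h using 1; abel⟩
  induction n generalizing z with
  | zero => simp only [Nat.cast_zero, zero_mul] at hn; linarith
  | succ n ih =>
    rw [Nat.cast_succ, add_one_mul] at hn
    rcases lt_or_ge z.1 0 with hx | hx
    · rcases lt_or_ge z.2 P.q with hy | hy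
      · refine ⟨1, 0, L.zero_mem, ⟨?_, ?_⟩, ?_, ?_⟩ <;>
          simp only [sub_zero, Prod.fst_add, Prod.snd_add, left_one, right_one, bottom_eq,
            top_one] <;> linarith
      · apply step (snd_mem_of_mem_biFan P.basis_mem)
        apply ih <;> simp only [basis, Prod.fst_sub, Prod.snd_sub] <;> linarith
    · rcases lt_or_ge z.2 P.p with hy | hy
      · refine ⟨0, 0, L.zero_mem, ⟨?_, ?_⟩, ?_, ?_⟩ <;>
          simp only [sub_zero, Prod.fst_add, Prod.snd_add, left_zero, right_zero, bottom_eq,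
            top_zero] <;> linarith
      · apply step (fst_mem_of_mem_biFan P.basis_mem)
        apply ih <;> simp only [basis, Prod.fst_sub, Prod.snd_sub] <;> linarith

lemma exists_halfOpen (z : Plane) : ∃ i, ∃ l ∈ L, z - l ∈ P.halfOpen i := by
  obtain ⟨l, hl, h1, h2, h3⟩ := P.exists_add_mem_strip (z - P.w)
  obtain ⟨n, hn⟩ := exists_nat_gt ((z - P.w + l).2 / min P.p P.q)
  obtain ⟨i, l', hl', h⟩ := P.exists_sub_mem_halfOpen_of_mem_strip n h1 h2 h3
    ((div_lt_iff₀ (lt_min P.p_pos P.q_pos)).1 hn)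
  refine ⟨i, l' - l, L.sub_mem hl' hl, ?_⟩
  convert h using 1
  abel

lemma mkQ_notMem_verticalSpine {i : Fin 2} {z : Plane} (hz : z ∈ interior (P.rect i)) :
    L.mkQ z ∉ P.verticalSpine := by
  rw [verticalSpine_eq]
  rintro ⟨y, ⟨hy1, hy2, hy3⟩, hyz⟩
  have hlong := P.eq_zero_or_long_of_mem (mkQ_eq_mkQ_iff.1 hyz)
  rw [sub_eq_zero, le_abs, le_abs] at hlong
  rw [mem_singleton_iff] at hy1
  rw [interior_rect] at hz
  obtain ⟨⟨h1, h2⟩, h3, h4⟩ := hz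
  have hu := P.u_pos
  have hv := P.v_pos
  have hp := P.p_pos
  have hq := P.q_pos
  fin_cases i <;>
    simp only [Fin.zero_eta, Fin.mk_one, left_zero, left_one, right_zero, right_one, bottom_eq,
      top_zero, top_one, Prod.fst_sub, Prod.snd_sub] at h1 h2 h3 h4 hlong <;>
    obtain rfl | (h | h) | (h | h) | h | h | h | h := hlong <;> linarith

lemma mkQ_notMem_horizontalSpine {i : Fin 2} {z : Plane} (hz : z ∈ interior (P.rect i)) :
    L.mkQ z ∉ P.horizontalSpine := by
  rw [horizontalSpine_eq]
  rintro ⟨y, ⟨⟨hy2, hy3⟩, hy1⟩, hyz⟩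
  have hlong := P.eq_zero_or_long_of_mem (mkQ_eq_mkQ_iff.1 hyz)
  rw [sub_eq_zero, le_abs, le_abs] at hlong
  rw [mem_singleton_iff] at hy1
  rw [interior_rect] at hz
  obtain ⟨⟨h1, h2⟩, h3, h4⟩ := hz
  have hu := P.u_pos
  have hv := P.v_pos
  have hp := P.p_pos
  have hq := P.q_pos
  fin_cases i <;>
    simp only [Fin.zero_eta, Fin.mk_one, left_zero, left_one, right_zero, right_one, bottom_eq,
      top_zero, top_one, Prod.fst_sub, Prod.snd_sub] at h1 h2 h3 h4 hlong <;>
    obtain rfl | (h | h) | (h | h) | h | h | h | h := hlong <;> linarith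

end BiPartition

/-! ### Equivalence of bi-partitions and diagonal maps -/

lemma exists_eq_preimage_sub_of_image_mkQ_eq {E : Type*} [AddCommGroup E] [TopologicalSpace E]
    [ContinuousSub E] {L : Submodule ℤ E} {U V : Set E} (hU : IsPreconnected U)
    (hne : U.Nonempty) (hV : IsOpen V) (hinj : InjOn L.mkQ V) (h : L.mkQ '' U = L.mkQ '' V) :
    ∃ l ∈ L, U = (fun z => z - l) ⁻¹' V := by
  have unique {z l l' : E} (hl : l ∈ L) (hl' : l' ∈ L) (hz : z - l ∈ V) (hz' : z - l' ∈ V) :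
      l = l' := by
    have hmem : z - l - (z - l') ∈ L := by
      rw [sub_sub_sub_cancel_left]
      exact L.sub_mem hl' hl
    exact sub_right_inj.1 (hinj hz hz' (mkQ_eq_mkQ_iff.2 hmem))
  have cover : ∀ z ∈ U, ∃ l ∈ L, z - l ∈ V := fun z hz => by
    obtain ⟨y, hy, hyz⟩ : L.mkQ z ∈ L.mkQ '' V := h ▸ mem_image_of_mem L.mkQ hz
    exact ⟨z - y, mkQ_eq_mkQ_iff.1 hyz.symm, by rwa [sub_sub_cancel]⟩
  obtain ⟨z₀, hz₀⟩ := hne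
  obtain ⟨l, hl, hz₀l⟩ := cover z₀ hz₀
  have hopen (l : E) : IsOpen ((fun z => z - l) ⁻¹' V) := hV.preimage (by fun_prop)
  have hsub : U ⊆ (fun z => z - l) ⁻¹' V := by
    refine hU.subset_left_of_subset_union (hopen l)
      (v := ⋃ l' ∈ {l' | l' ∈ L ∧ l' ≠ l}, (fun z => z - l') ⁻¹' V)
      (isOpen_biUnion fun l' _ => hopen l') ?_ (fun z hz => ?_) ⟨z₀, hz₀, hz₀l⟩
    · refine disjoint_left.2 fun z hz hz' => ?_
      obtain ⟨l', ⟨hl', hne⟩, hz''⟩ := mem_iUnion₂.1 hz'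
      exact hne (unique hl' hl hz'' hz)
    · obtain ⟨l', hl', hz'⟩ := cover z hz
      obtain rfl | hne := eq_or_ne l' l
      · exact Or.inl hz'
      · exact Or.inr (mem_iUnion₂.2 ⟨l', ⟨hl', hne⟩, hz'⟩)
  refine ⟨l, hl, hsub.antisymm fun z hz => ?_⟩
  obtain ⟨y, hy, hyz⟩ : L.mkQ (z - l) ∈ L.mkQ '' U := h ▸ mem_image_of_mem L.mkQ hz
  rw [sub_eq_add_neg, mkQ_add_of_mem z (L.neg_mem hl)] at hyz
  have hyl : L.mkQ (y - l) = L.mkQ (z - l) := by rw [map_sub, map_sub, hyz]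
  rwa [← sub_left_inj.1 (hinj (hsub hy) hz hyl)]

lemma diam_image_mul_add (α c : ℝ) (s : Set ℝ) :
    Metric.diam ((fun x => α * x + c) '' s) = |α| * Metric.diam s := by
  rw [show (fun x => α * x + c) = (· + c) ∘ (α • ·) from rfl, image_comp,
    (isometry_add_right c).diam_image, image_smul, diam_smul₀, Real.norm_eq_abs]

lemma image_mul_Icc_of_pair_eq {α a b a' b' : ℝ} (hab : a ≤ b) (hab' : a' ≤ b')
    (h : ({α * a, α * b} : Set ℝ) = {a', b'}) : (fun x => α * x) '' Icc a b = Icc a' b' := by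
  rw [← uIcc_of_le hab, ← uIcc_of_le hab', image_const_mul_uIcc]
  obtain ⟨rfl, rfl⟩ | ⟨rfl, rfl⟩ := pair_eq_pair_iff.1 h
  · rfl
  · exact uIcc_comm _ _

section DiagMap

variable {α β : ℝ}

lemma image_diagMap_prod (s t : Set ℝ) :
    diagMap α β '' s ×ˢ t = ((fun x => α * x) '' s) ×ˢ ((fun x => β * x) '' t) :=
  prodMap_image_prod _ _ s t

lemma image_diagMap_interior (hα : α ≠ 0) (hβ : β ≠ 0) (s : Set Plane) :
    diagMap α β '' interior s = interior (diagMap α β '' s) :=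
  ((Homeomorph.mulLeft₀ α hα).prodCongr (Homeomorph.mulLeft₀ β hβ)).image_interior s

variable {L : Submodule ℤ Plane}

lemma diagMap_mem_iff_of_map_eq (hα : α ≠ 0) (hβ : β ≠ 0)
    (h : L.map ((diagMap α β).restrictScalars ℤ) = L) (z : Plane) : diagMap α β z ∈ L ↔ z ∈ L := by
  conv_lhs => rw [← h]
  exact (diagMap_injective hα hβ).mem_set_image

lemma diagMap_mem_iff_of_diagPair_mem_biFan {b : Plane × Plane} (hb : b ∈ biFan L) (hα : 0 < α)
    (hβ : 0 < β) (h : diagPair α β b ∈ biFan L) (z : Plane) : diagMap α β z ∈ L ↔ z ∈ L :=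
  diagMap_mem_iff_of_map_eq hα.ne' hβ.ne'
    ((diagPair_mem_biFan hb hα hβ).2.2.2.2.symm.trans h.2.2.2.2) z

lemma diagMap_mem_iff_of_diagPair_mirror_mem_biFan {b : Plane × Plane} (hb : b ∈ biFan L)
    (hα : 0 < α) (hβ : 0 < β) (h : diagPair α β (mirror b) ∈ biFan L) (z : Plane) :
    diagMap (-α) β z ∈ L ↔ z ∈ L := by
  have hmap := (diagPair_mem_biFan (mirror_mem_biFan hb) hα hβ).2.2.2.2.symm.trans h.2.2.2.2
  have hcomp : (diagMap α β).restrictScalars ℤ ∘ₗ (diagMap (-1) 1).restrictScalars ℤ =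
      (diagMap (-α) β).restrictScalars ℤ := by
    ext z <;> simp [diagMap_apply]
  rw [← Submodule.map_comp, hcomp] at hmap
  exact diagMap_mem_iff_of_map_eq (neg_ne_zero.2 hα.ne') hβ.ne' hmap z

lemma exists_homeomorph_diagMap (hα : α ≠ 0) (hβ : β ≠ 0)
    (hL : ∀ z, diagMap α β z ∈ L ↔ z ∈ L) :
    ∃ h : (Plane ⧸ L) ≃ₜ (Plane ⧸ L), ∀ z, h (L.mkQ z) = L.mkQ (diagMap α β z) := by
  have hL' : ∀ z, diagMap α⁻¹ β⁻¹ z ∈ L ↔ z ∈ L := fun z => by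
    rw [← hL, diagMap_apply_diagMap_inv hα hβ]
  have hcont (a b : ℝ) : Continuous fun z => L.mkQ (diagMap a b z) :=
    continuous_quotient_mk'.comp (LinearMap.continuous_of_finiteDimensional _)
  refine ⟨⟨⟨L.mapQ L ((diagMap α β).restrictScalars ℤ) fun z hz => (hL z).2 hz,
    L.mapQ L ((diagMap α⁻¹ β⁻¹).restrictScalars ℤ) fun z hz => (hL' z).2 hz, ?_, ?_⟩,
    continuous_quot_lift _ (hcont α β), continuous_quot_lift _ (hcont α⁻¹ β⁻¹)⟩, fun z => rfl⟩
  · exact L.mkQ_surjective.forall.2 fun z =>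
      congrArg L.mkQ (diagMap_inv_apply_diagMap hα hβ z)
  · exact L.mkQ_surjective.forall.2 fun z =>
      congrArg L.mkQ (diagMap_apply_diagMap_inv hα hβ z)

end DiagMap

namespace BiPartition

variable {L : Submodule ℤ Plane}

lemma injOn_mkQ_interior_rect (P : BiPartition L) (i : Fin 2) :
    InjOn L.mkQ (interior (P.rect i)) := by
  intro z hz w hw h
  have hunique := P.halfOpen_unique (i := i) (j := i) (z := z) L.zero_mem (mkQ_eq_mkQ_iff.1 h)
    (by simpa using P.interior_rect_subset_halfOpen i hz)
    (by simpa using P.interior_rect_subset_halfOpen i hw)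
  exact (sub_eq_zero.1 hunique.2.symm)

lemma size_eq_of_image_affine {P Q : BiPartition L} {i j : Fin 2} {α β : ℝ} {c : Plane}
    (h : L.mkQ '' ((fun z : Plane => (α * z.1 + c.1, β * z.2 + c.2)) '' interior (P.rect i)) =
      Q.tile j) :
    Q.width j = |α| * P.width i ∧ Q.height j = |β| * P.height i := by
  have himg : (fun z : Plane => (α * z.1 + c.1, β * z.2 + c.2)) '' interior (P.rect i) =
      ((fun x => α * x + c.1) '' Ioo (P.left i) (P.right i)) ×ˢ
        ((fun y => β * y + c.2) '' Ioo (P.bottom i) (P.top i)) := by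
    rw [P.interior_rect]
    exact prodMap_image_prod (fun x => α * x + c.1) (fun y => β * y + c.2) _ _
  have hpre (l : Plane) : (fun z => z - l) ⁻¹' interior (Q.rect j) =
      ((· - l.1) ⁻¹' Ioo (Q.left j) (Q.right j)) ×ˢ
        ((· - l.2) ⁻¹' Ioo (Q.bottom j) (Q.top j)) := by
    rw [Q.interior_rect]
    rfl
  have hconn := (isPreconnected_Ioo (a := P.left i) (b := P.right i)).image
    (fun x => α * x + c.1) (by fun_prop)
  have hconn' := (isPreconnected_Ioo (a := P.bottom i) (b := P.top i)).image
    (fun y => β * y + c.2) (by fun_prop)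
  have hne := ((nonempty_Ioo.2 (P.left_lt_right i)).image (fun x => α * x + c.1)).prod
    ((nonempty_Ioo.2 (P.bottom_lt_top i)).image (fun y => β * y + c.2))
  rw [himg] at h
  obtain ⟨l, -, hl⟩ := exists_eq_preimage_sub_of_image_mkQ_eq (hconn.prod hconn') hne
    isOpen_interior (Q.injOn_mkQ_interior_rect j) h
  rw [hpre, prod_eq_prod_iff_of_nonempty hne, preimage_sub_const_Ioo, preimage_sub_const_Ioo] at hl
  have hdiam := congrArg Metric.diam hl.1
  have hdiam' := congrArg Metric.diam hl.2
  have hQ := Q.left_lt_right j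
  have hQ' := Q.bottom_lt_top j
  rw [diam_image_mul_add, Real.diam_Ioo (P.left_lt_right i).le, Real.diam_Ioo (by linarith),
    add_sub_add_right_eq_sub, right_sub_left, right_sub_left] at hdiam
  rw [diam_image_mul_add, Real.diam_Ioo (P.bottom_lt_top i).le, Real.diam_Ioo (by linarith),
    add_sub_add_right_eq_sub, top_sub_bottom, top_sub_bottom] at hdiam'
  exact ⟨hdiam.symm, hdiam'.symm⟩

end BiPartition

namespace HyperbolicToralAut

variable {L : Submodule ℤ Plane} (D : HyperbolicToralAut L) {P Q : BiPartition L}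

theorem diagRel_of_equivalent [DiscreteTopology L] [IsZLattice ℝ L] (h : D.Equivalent P Q) :
    DiagRel P.basis Q.basis := by
  obtain ⟨h, hD, σ, hσ⟩ := h
  obtain ⟨α, β, c, hα, hβ, hform⟩ := D.exists_affine_of_commute hD
  have hsize (i : Fin 2) :
      Q.width (σ i) = |α| * P.width i ∧ Q.height (σ i) = |β| * P.height i := by
    apply BiPartition.size_eq_of_image_affine (c := c)
    rw [← hσ i, BiPartition.tile, image_image, image_image]
    exact image_congr fun z _ => (hform z).symm
  refine ⟨|α|, |β|, abs_pos.2 hα, abs_pos.2 hβ, ?_⟩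
  have hσ' : σ = 1 ∨ σ = Equiv.swap 0 1 := by
    clear hσ hsize
    decide +revert
  obtain ⟨h1, h2⟩ := hsize 0
  obtain ⟨h3, h4⟩ := hsize 1
  obtain rfl | rfl := hσ'
  · left
    simp_all [BiPartition.basis, diagPair, diagMap_apply]
  · right
    simp_all [BiPartition.basis, diagPair, mirror, diagMap_apply]

lemma equivalent_and_isBerg_of_sides {α β : ℝ} (hα : α ≠ 0) (hβ : β ≠ 0)
    (hL : ∀ z, diagMap α β z ∈ L ↔ z ∈ L) (σ : Equiv.Perm (Fin 2))
    (hx : ∀ i, ({α * P.left i, α * P.right i} : Set ℝ) = {Q.left (σ i), Q.right (σ i)})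
    (hy : ∀ i, ({β * P.bottom i, β * P.top i} : Set ℝ) = {Q.bottom (σ i), Q.top (σ i)}) :
    D.Equivalent P Q ∧ (D.IsBerg Q → D.IsBerg P) := by
  obtain ⟨h, hh⟩ := exists_homeomorph_diagMap hα hβ hL
  have hcomm : ∀ x, h (D.torusMap x) = D.torusMap (h x) := by
    refine L.mkQ_surjective.forall.2 fun z => ?_
    rw [D.torusMap_mkQ, hh, hh, D.torusMap_mkQ]
    simp only [diagMap_apply, D.planeMap_apply, mul_left_comm]
  have image_h_mkQ (s : Set Plane) : h '' (L.mkQ '' s) = L.mkQ '' (diagMap α β '' s) :=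
    image_comm hh
  have hIccx (i : Fin 2) := image_mul_Icc_of_pair_eq (P.left_lt_right i).le
    (Q.left_lt_right (σ i)).le (hx i)
  have hIccy (i : Fin 2) := image_mul_Icc_of_pair_eq (P.bottom_lt_top i).le
    (Q.bottom_lt_top (σ i)).le (hy i)
  have htile (i : Fin 2) : h '' P.tile i = Q.tile (σ i) := by
    rw [BiPartition.tile, image_h_mkQ, image_diagMap_interior hα hβ, BiPartition.rect,
      image_diagMap_prod, hIccx, hIccy]
    rfl
  have hhorizontal : h '' P.horizontalSpine = Q.horizontalSpine := by
    simp only [BiPartition.horizontalSpine, image_h_mkQ, image_iUnion, image_diagMap_prod, hIccx,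
      image_pair, hy]
    exact σ.surjective.iUnion_comp
      fun j => L.mkQ '' Icc (Q.left j) (Q.right j) ×ˢ ({Q.bottom j, Q.top j} : Set ℝ)
  have hvertical : h '' P.verticalSpine = Q.verticalSpine := by
    simp only [BiPartition.verticalSpine, image_h_mkQ, image_iUnion, image_diagMap_prod, hIccy,
      image_pair, hx]
    exact σ.surjective.iUnion_comp
      fun j => L.mkQ '' ({Q.left j, Q.right j} : Set ℝ) ×ˢ Icc (Q.bottom j) (Q.top j)
  refine ⟨⟨h, hcomm, σ, htile⟩, fun hQ => ⟨?_, ?_⟩⟩ <;> rw [← image_subset_image_iff h.injective]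
  · rw [image_comm hcomm, hhorizontal]
    exact hQ.1
  · rw [image_comm hcomm, hvertical]
    exact hQ.2

lemma equivalent_and_isBerg_of_diagPair {α β : ℝ} (hα : 0 < α) (hβ : 0 < β)
    (hw : Q.w = diagMap α β P.w) (h : Q.basis = diagPair α β P.basis) :
    D.Equivalent P Q ∧ (D.IsBerg Q → D.IsBerg P) := by
  have hL := diagMap_mem_iff_of_diagPair_mem_biFan P.basis_mem hα hβ (h ▸ Q.basis_mem)
  simp only [BiPartition.basis, diagPair, diagMap_apply, Prod.mk.injEq, mul_neg, neg_inj] at h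
  obtain ⟨⟨hv, hp⟩, hu, hq⟩ := h
  apply D.equivalent_and_isBerg_of_sides hα.ne' hβ.ne' hL 1 <;>
    simp [Fin.forall_fin_two, hw, diagMap_apply, hu, hv, hp, hq, mul_add, mul_sub]

lemma equivalent_and_isBerg_of_diagPair_mirror {α β : ℝ} (hα : 0 < α) (hβ : 0 < β)
    (hw : Q.w = diagMap (-α) β P.w) (h : Q.basis = diagPair α β (mirror P.basis)) :
    D.Equivalent P Q ∧ (D.IsBerg Q → D.IsBerg P) := by
  have hL := diagMap_mem_iff_of_diagPair_mirror_mem_biFan P.basis_mem hα hβ (h ▸ Q.basis_mem)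
  simp only [BiPartition.basis, diagPair, mirror, diagMap_apply, Prod.mk.injEq, neg_mul,
    one_mul, mul_neg, neg_inj, neg_neg] at h
  obtain ⟨⟨hv, hp⟩, hu, hq⟩ := h
  refine D.equivalent_and_isBerg_of_sides (neg_ne_zero.2 hα.ne') hβ.ne' hL (Equiv.swap 0 1)
    (Fin.forall_fin_two.2 ⟨?_, ?_⟩) ?_
  · rw [pair_comm]
    simp [hw, diagMap_apply, hv, mul_add, sub_eq_add_neg]
  · rw [pair_comm]
    simp [hw, diagMap_apply, hu, mul_sub, neg_add_eq_sub]
  · simp [Fin.forall_fin_two, hw, diagMap_apply, hp, hq, mul_add]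

theorem exists_equivalent_of_diagRel (h : DiagRel P.basis Q.basis) :
    ∃ t, D.Equivalent (P.translate t) Q ∧ (D.IsBerg Q → D.IsBerg (P.translate t)) := by
  have exists_corner {α β : ℝ} (hα : α ≠ 0) (hβ : β ≠ 0) :
      ∃ t, Q.w = diagMap α β (P.translate t).w :=
    ⟨diagMap α⁻¹ β⁻¹ Q.w - P.w, by
      simp only [BiPartition.translate, add_sub_cancel, diagMap_apply_diagMap_inv hα hβ]⟩
  obtain ⟨α, β, hα, hβ, h | h⟩ := h
  · obtain ⟨t, ht⟩ := exists_corner hα.ne' hβ.ne'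
    exact ⟨t, D.equivalent_and_isBerg_of_diagPair hα hβ ht h⟩
  · obtain ⟨t, ht⟩ := exists_corner (neg_ne_zero.2 hα.ne') hβ.ne'
    exact ⟨t, D.equivalent_and_isBerg_of_diagPair_mirror hα hβ ht h⟩

theorem sameShape_iff_diagRel [DiscreteTopology L] [IsZLattice ℝ L] :
    D.SameShape P Q ↔ DiagRel P.basis Q.basis :=
  ⟨fun ⟨t, h⟩ => D.diagRel_of_equivalent (P := P.translate t) h,
    fun h => (D.exists_equivalent_of_diagRel h).imp fun _ ht => ht.1⟩

end HyperbolicToralAut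

/-! ### Every basis in the bi-fan carries a Berg partition -/

lemma nonneg_and_one_le_of_mul_eq {u v p q m : ℝ} {a b : ℤ} (hu : 0 < u) (hv : 0 < v) (hp : 0 < p)
    (hq : 0 < q) (hm : 0 < m) (hm1 : m < 1) (h : (b + m) * u = a * v) (h' : 0 < a * p + b * q) :
    (0 : ℝ) ≤ b ∧ (1 : ℝ) ≤ a := by
  have hb : 0 ≤ b := by
    by_contra! hneg
    have hb1 : (b : ℝ) ≤ -1 := by exact_mod_cast Int.le_sub_one_of_lt hneg
    have ha : a * v < 0 := h ▸ mul_neg_of_neg_of_pos (by linarith) hu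
    have hap : a * p < 0 := mul_neg_of_neg_of_pos ((neg_iff_pos_of_mul_neg ha).2 hv) hp
    have hbq : b * q < 0 := mul_neg_of_neg_of_pos (by linarith) hq
    linarith
  have hb0 : (0 : ℝ) ≤ b := by exact_mod_cast hb
  have ha : 0 < a * v := h ▸ mul_pos (by linarith) hu
  have ha0 : 0 < a := by exact_mod_cast (pos_iff_pos_of_mul_pos ha).2 hv
  exact ⟨hb0, by exact_mod_cast ha0⟩

lemma mul_le_of_det_eq_one {a b c d m u v : ℝ} (hu : 0 < u) (hv : 0 < v) (hm : 0 < m) (hb : 0 ≤ b)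
    (hd : 1 ≤ d) (hdet : a * d - b * c = 1) (h : (b + m) * u = a * v) (h' : (c + m) * v = d * u) :
    m * u ≤ v := by
  have htrace : m * (b + c + m) = 1 := by
    apply mul_right_cancel₀ (mul_pos hu hv).ne'
    linear_combination u * v * hdet + (c + m) * v * h + a * v * h'
  calc m * u ≤ m * (d * u) := by gcongr; exact le_mul_of_one_le_left hu.le hd
    _ = m * (c + m) * v := by rw [← h', mul_assoc]
    _ ≤ v := mul_le_of_le_one_left hv.le (by linarith [mul_nonneg hm.le hb])

lemma mul_mem_Icc_of_abs_lt_one {k u v x : ℝ} (hu : 0 < u) (hv : 0 < v) (hk : |k| < 1)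
    (hneg : k < 0 → |k| * u ≤ v ∧ |k| * v ≤ u) (hx : x ∈ Icc (-v) u) : k * x ∈ Icc (-v) u := by
  obtain ⟨hxv, hxu⟩ := hx
  obtain h0 | h0 := le_or_gt 0 k
  · rw [abs_of_nonneg h0] at hk
    constructor <;> nlinarith
  · obtain ⟨huv, hvu⟩ := hneg h0
    rw [abs_of_neg h0] at huv hvu
    constructor <;> nlinarith

namespace HyperbolicToralAut

variable {L : Submodule ℤ Plane} (D : HyperbolicToralAut L) (P : BiPartition L)

lemma exists_abs_coord_of_mu_mul_lam_neg (h : D.mu * D.lam < 0) :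
    ∃ a b c d : ℤ, |D.mu| * P.u = a * P.v - b * P.u ∧ |D.lam| * P.q = a * P.p + b * P.q ∧
      |D.mu| * P.v = d * P.u - c * P.v ∧ |D.lam| * P.p = c * P.p + d * P.q := by
  have hDe : (D.mu * P.v, D.lam * P.p) ∈ L := (D.map_mem_iff _).2 (fst_mem_of_mem_biFan P.basis_mem)
  have hDf : (D.mu * -P.u, D.lam * P.q) ∈ L :=
    (D.map_mem_iff _).2 (snd_mem_of_mem_biFan P.basis_mem)
  have hmem : (-(|D.mu| * P.v), |D.lam| * P.p) ∈ L ∧ (|D.mu| * P.u, |D.lam| * P.q) ∈ L := by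
    obtain ⟨hmu, hlam⟩ | ⟨hmu, hlam⟩ := mul_neg_iff.1 h
    · rw [abs_of_pos hmu, abs_of_neg hlam]
      simpa only [Prod.neg_mk, neg_mul, mul_neg, neg_neg]
        using And.intro (L.neg_mem hDe) (L.neg_mem hDf)
    · rw [abs_of_neg hmu, abs_of_pos hlam]
      simpa only [neg_mul, mul_neg, neg_neg] using And.intro hDe hDf
  obtain ⟨c, d, hcd, hcd'⟩ := (mem_iff_of_mem_biFan P.basis_mem).1 hmem.1
  obtain ⟨a, b, hab, hab'⟩ := (mem_iff_of_mem_biFan P.basis_mem).1 hmem.2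
  simp only [BiPartition.basis] at hab hab' hcd hcd'
  exact ⟨a, b, c, d, by linarith, hab', by linarith, hcd'⟩

lemma abs_mu_mul_le_of_mu_mul_lam_neg (h : D.mu * D.lam < 0) :
    |D.mu| * P.u ≤ P.v ∧ |D.mu| * P.v ≤ P.u := by
  obtain ⟨a, b, c, d, hu, hq, hv, hp⟩ := D.exists_abs_coord_of_mu_mul_lam_neg P h
  have hlam : 0 < |D.lam| := abs_pos.2 D.lam_ne_zero
  have hab : (b + |D.mu|) * P.u = a * P.v := by linarith
  have hdc : (c + |D.mu|) * P.v = d * P.u := by linarith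
  obtain ⟨hb, ha⟩ := nonneg_and_one_le_of_mul_eq P.u_pos P.v_pos P.p_pos P.q_pos D.abs_mu_pos
    D.abs_mu_lt_one hab (hq ▸ mul_pos hlam P.q_pos)
  obtain ⟨hc, hd⟩ := nonneg_and_one_le_of_mul_eq P.v_pos P.u_pos P.q_pos P.p_pos D.abs_mu_pos
    D.abs_mu_lt_one hdc (by linarith [mul_pos hlam P.p_pos])
  -- Compare the areas of the fundamental domains spanned by the basis and by its image.
  have hdet : (a : ℝ) * d - b * c = 1 := by
    have harea : P.u * P.p + P.v * P.q ≠ 0 :=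
      (add_pos (mul_pos P.u_pos P.p_pos) (mul_pos P.v_pos P.q_pos)).ne'
    apply mul_right_cancel₀ harea
    have himage : |D.mu| * |D.lam| * (P.u * P.p + P.v * P.q) =
        |D.mu| * P.u * (|D.lam| * P.p) + |D.lam| * P.q * (|D.mu| * P.v) := by ring
    rw [D.abs_mu_mul_abs_lam, hu, hq, hv, hp] at himage
    linear_combination -himage
  exact ⟨mul_le_of_det_eq_one P.u_pos P.v_pos D.abs_mu_pos hb hd hdet hab hdc,
    mul_le_of_det_eq_one P.v_pos P.u_pos D.abs_mu_pos hc ha (by linarith) hdc hab⟩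

variable {P}

lemma isBerg_of_segments
    (hs : ∀ z ∈ P.hSegment, ∃ l ∈ L, D.planeMap z + l ∈ P.hSegment)
    (hu : P.vSegment ⊆ D.planeMap '' P.vSegment) : D.IsBerg P := by
  have image_mkQ (S : Set Plane) : D.torusMap '' (L.mkQ '' S) = L.mkQ '' (D.planeMap '' S) :=
    image_comm D.torusMap_mkQ
  rw [IsBerg, P.horizontalSpine_eq, P.verticalSpine_eq, image_mkQ, image_mkQ]
  refine ⟨?_, image_mono hu⟩
  rintro _ ⟨_, ⟨z, hz, rfl⟩, rfl⟩
  obtain ⟨l, hl, h⟩ := hs z hz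
  exact BiPartition.mkQ_mem_image hl h

lemma vSegment_subset_image (hw : P.w.1 = 0)
    (h : ∀ y ∈ Icc P.w.2 (P.w.2 + (P.p + P.q)), y / D.lam ∈ Icc P.w.2 (P.w.2 + (P.p + P.q))) :
    P.vSegment ⊆ D.planeMap '' P.vSegment := by
  rintro ⟨x, y⟩ ⟨hx, hy⟩
  refine ⟨(x, y / D.lam), ⟨hx, h y hy⟩, ?_⟩
  obtain rfl : x = 0 := hx.trans hw
  rw [planeMap_apply, mul_zero, mul_div_cancel₀ _ D.lam_ne_zero]

lemma isBerg_of_lam_pos (hw : P.w = 0) (hlam : 0 < D.lam) : D.IsBerg P := by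
  refine D.isBerg_of_segments (fun z ⟨hx, hy⟩ => ⟨0, L.zero_mem, ?_, ?_⟩)
    (D.vSegment_subset_image (congrArg Prod.fst hw) fun y hy => ?_)
  · rw [hw, Prod.fst_zero, zero_sub, zero_add] at hx ⊢
    rw [add_zero]
    exact mul_mem_Icc_of_abs_lt_one P.u_pos P.v_pos D.abs_mu_lt_one
      (fun hmu => D.abs_mu_mul_le_of_mu_mul_lam_neg P (mul_neg_of_neg_of_pos hmu hlam)) hx
  · rw [mem_singleton_iff, hw, Prod.snd_zero] at hy ⊢
    rw [add_zero, planeMap_apply, hy, mul_zero]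
  · rw [hw, Prod.snd_zero, zero_add] at hy ⊢
    have hlam1 := abs_of_pos hlam ▸ D.one_lt_abs_lam
    exact ⟨div_nonneg hy.1 hlam.le, (div_le_self hy.1 hlam1.le).trans hy.2⟩

/- The corner is placed so that `λ` takes the lower end of the vertical segment to its upper end. -/
lemma isBerg_of_lam_neg (hw : P.w = (0, -(P.p + P.q) / (1 - D.lam))) (hlam : D.lam < 0) :
    D.IsBerg P := by
  have hw1 : P.w.1 = 0 := congrArg Prod.fst hw
  have hw2 : D.lam * P.w.2 = P.w.2 + (P.p + P.q) := by
    rw [hw, ← sub_eq_iff_eq_add']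
    field_simp [show 1 - D.lam ≠ 0 by linarith]
    ring
  refine D.isBerg_of_segments (fun z ⟨hx, hy⟩ => ⟨-(P.basis.1 + P.basis.2), L.neg_mem
    (L.add_mem (fst_mem_of_mem_biFan P.basis_mem) (snd_mem_of_mem_biFan P.basis_mem)), ?_, ?_⟩)
    (D.vSegment_subset_image hw1 fun y ⟨hy, hy'⟩ => ?_)
  · rw [hw1, zero_sub, zero_add] at hx ⊢
    have hmem : -D.mu * z.1 ∈ Icc (-P.v) P.u := by
      refine mul_mem_Icc_of_abs_lt_one P.u_pos P.v_pos (by rw [abs_neg]; exact D.abs_mu_lt_one)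
        (fun hmu => ?_) hx
      rw [abs_neg]
      exact D.abs_mu_mul_le_of_mu_mul_lam_neg P (mul_neg_of_pos_of_neg (neg_neg_iff_pos.1 hmu) hlam)
    simp only [planeMap_apply, BiPartition.basis, Prod.fst_add, Prod.fst_neg]
    constructor <;> linarith [hmem.1, hmem.2]
  · rw [mem_singleton_iff] at hy ⊢
    simp only [planeMap_apply, BiPartition.basis, Prod.snd_add, Prod.snd_neg, hy, hw2]
    ring
  · have hlam1 := abs_of_neg hlam ▸ D.one_lt_abs_lam
    rw [mem_Icc, le_div_iff_of_neg hlam, div_le_iff_of_neg hlam]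
    constructor
    · linarith
    · nlinarith [P.p_pos, P.q_pos]

theorem exists_isBerg {b : Plane × Plane} (hb : b ∈ biFan L) :
    ∃ P : BiPartition L, P.basis = b ∧ D.IsBerg P := by
  obtain ⟨he1, he2, hf1, hf2, hspan⟩ := hb
  let P (w : Plane) : BiPartition L :=
    { u := -b.2.1, v := b.1.1, p := b.1.2, q := b.2.2, w := w, u_pos := neg_pos.2 hf1
      v_pos := he1, p_pos := he2, q_pos := hf2, span_eq := by rwa [neg_neg] }
  have hP (w : Plane) : (P w).basis = b := by simp only [P, BiPartition.basis, neg_neg]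
  obtain hlam | hlam := lt_or_gt_of_ne D.lam_ne_zero
  · exact ⟨P (0, -(b.1.2 + b.2.2) / (1 - D.lam)), hP _, D.isBerg_of_lam_neg rfl hlam⟩
  · exact ⟨P 0, hP _, D.isBerg_of_lam_pos rfl hlam⟩

end HyperbolicToralAut

/-! ### The connectivity matrix of a Berg partition -/

lemma sub_eq_sum_natCard_mul_of_Ico_eq_iUnion {ι : Type*} [Fintype ι] {X : ι → Type*} {h : ι → ℝ}
    (hh : ∀ j, 0 < h j) {c d : Sigma X → ℝ} (hcd : ∀ s, d s - c s = h s.1)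
    (hdisj : Pairwise fun s t => Disjoint (Ico (c s) (d s)) (Ico (c t) (d t))) {a b : ℝ}
    (hab : a ≤ b) (hunion : Ico a b = ⋃ s, Ico (c s) (d s)) :
    b - a = ∑ j, Nat.card (X j) * h j := by
  have hlt (s : Sigma X) : c s < d s := sub_pos.1 (hcd s ▸ hh s.1)
  have : Countable (Sigma X) :=
    Pairwise.countable_of_isOpen_disjoint
      (hdisj.mono fun s t hst => hst.mono Ioo_subset_Ico_self Ioo_subset_Ico_self)
      (fun _ => isOpen_Ioo) fun s => nonempty_Ioo.2 (hlt s)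
  have hvolume : ENNReal.ofReal (b - a) =
      ∑ j, (ENat.card (X j) : ENNReal) * ENNReal.ofReal (h j) := by
    rw [← Real.volume_Ico, hunion, MeasureTheory.measure_iUnion hdisj fun s => measurableSet_Ico]
    simp only [Real.volume_Ico, hcd, ENNReal.tsum_sigma', tsum_fintype, ENNReal.tsum_const]
  have hfinite := ENNReal.sum_ne_top.1 (hvolume ▸ ENNReal.ofReal_ne_top)
  have toReal_card (j : ι) : (ENat.card (X j) : ENNReal).toReal = Nat.card (X j) := by
    cases finite_or_infinite (X j) <;> simp
  rw [← ENNReal.toReal_ofReal (sub_nonneg.2 hab), hvolume, ENNReal.toReal_sum hfinite]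
  simp only [ENNReal.toReal_mul, toReal_card, ENNReal.toReal_ofReal (hh _).le]

lemma exists_image_mul_Ioo_eq {k x y : ℝ} (hk : k ≠ 0) (hxy : x < y) :
    ∃ a b, a < b ∧ b - a = |k| * (y - x) ∧ ({a, b} : Set ℝ) = {k * x, k * y} ∧
      (fun t => k * t) '' Ioo x y = Ioo a b := by
  obtain hk | hk := lt_or_gt_of_ne hk
  · refine ⟨k * y, k * x, mul_lt_mul_of_neg_left hxy hk, ?_, pair_comm _ _, ?_⟩
    · rw [abs_of_neg hk]
      ring
    · refine ((Equiv.mulLeft₀ k hk.ne).image_eq_preimage_symm _).trans ?_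
      refine (preimage_const_mul_Ioo_of_neg x y (inv_lt_zero.2 hk)).trans ?_
      rw [div_inv_eq_mul, div_inv_eq_mul, mul_comm y, mul_comm x]
  · refine ⟨k * x, k * y, mul_lt_mul_of_pos_left hxy hk, ?_, rfl, image_mul_left_Ioo hk x y⟩
    rw [abs_of_pos hk, mul_sub]

namespace BiPartition

variable {L : Submodule ℤ Plane} (P : BiPartition L)

/-- The lattice vectors `l` such that `S` meets the interior of `R_j + l`. For `S` the image of the
interior of `R_i`, their number is an entry of the connectivity matrix. -/
def crossings (S : Set Plane) (j : Fin 2) : Set Plane :=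
  {l : Plane | l ∈ L ∧ (S ∩ ((fun z => z + l) '' interior (P.rect j))).Nonempty}

/-- The open box `Ioo a b ×ˢ Ioo a' b'` misses the vertical spine, and the horizontal sides of the
box lie in the horizontal spine. It is this Markov property of the images of the rectangles that
determines the connectivity matrix of a Berg partition. -/
structure IsMarkovBox (a b a' b' : ℝ) : Prop where
  mkQ_notMem : ∀ z ∈ Ioo a b ×ˢ Ioo a' b', L.mkQ z ∉ P.verticalSpine
  mkQ_mem : ∀ x ∈ Ioo a b, ∀ y ∈ ({a', b'} : Set ℝ), L.mkQ (x, y) ∈ P.horizontalSpine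

variable {P} {S : Set Plane} {j : Fin 2} {l : Plane} {a b a' b' : ℝ}

lemma mem_crossings :
    l ∈ P.crossings S j ↔ l ∈ L ∧ ∃ z ∈ interior (P.rect j), z + l ∈ S := by
  simp only [crossings, mem_ofPred_eq, inter_comm S, inter_nonempty, exists_mem_image]

lemma IsMarkovBox.bounds_of_mem_crossings (h : P.IsMarkovBox a b a' b')
    (hl : l ∈ P.crossings (Ioo a b ×ˢ Ioo a' b') j) :
    P.left j + l.1 ≤ a ∧ b ≤ P.right j + l.1 ∧ a' ≤ P.bottom j + l.2 ∧ P.top j + l.2 ≤ b' := by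
  obtain ⟨hl, z, hz, ⟨hza, hzb⟩, hzl⟩ := mem_crossings.1 hl
  rw [P.interior_rect] at hz
  obtain ⟨⟨hleft, hright⟩, hbottom, htop⟩ := hz
  simp only [Prod.fst_add, Prod.snd_add] at hza hzb hzl
  have side_notMem : ∀ x ∈ ({P.left j, P.right j} : Set ℝ), x + l.1 ∉ Ioo a b := by
    refine fun x hx hxab => h.mkQ_notMem ((x, z.2) + l) ⟨hxab, hzl⟩ ?_
    rw [mkQ_add_of_mem _ hl]
    exact mem_image_of_mem _ (mem_iUnion.2 ⟨j, hx, hbottom.le, htop.le⟩)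
  have end_notMem : ∀ y ∈ ({a', b'} : Set ℝ), y - l.2 ∉ Ioo (P.bottom j) (P.top j) := by
    intro y hy hyj
    apply P.mkQ_notMem_horizontalSpine (i := j) (z := (z.1, y - l.2))
    · rw [P.interior_rect]
      exact ⟨⟨hleft, hright⟩, hyj⟩
    · rw [← mkQ_add_of_mem _ hl, show ((z.1, y - l.2) : Plane) + l = (z.1 + l.1, y) from
        Prod.ext rfl (sub_add_cancel _ _)]
      exact h.mkQ_mem _ ⟨hza, hzb⟩ y hy
  refine ⟨?_, ?_, ?_, ?_⟩ <;> by_contra! hlt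
  · exact side_notMem _ (Or.inl rfl) ⟨hlt, by linarith⟩
  · exact side_notMem _ (Or.inr rfl) ⟨by linarith, hlt⟩
  · exact end_notMem _ (Or.inl rfl) ⟨by linarith, by linarith [hzl.1]⟩
  · exact end_notMem _ (Or.inr rfl) ⟨by linarith [hzl.2], by linarith⟩

lemma IsMarkovBox.sub_mem_halfOpen (h : P.IsMarkovBox a b a' b') {x y : ℝ} (hx : x ∈ Ioo a b)
    (hl : l ∈ P.crossings (Ioo a b ×ˢ Ioo a' b') j)
    (hy : y ∈ Ico (P.bottom j + l.2) (P.top j + l.2)) : (x, y) - l ∈ P.halfOpen j := by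
  obtain ⟨hleft, hright, -, -⟩ := h.bounds_of_mem_crossings hl
  exact ⟨⟨le_sub_iff_add_le.2 (hleft.trans hx.1.le), sub_lt_iff_lt_add.2 (hx.2.trans_le hright)⟩,
    le_sub_iff_add_le.2 hy.1, sub_lt_iff_lt_add.2 hy.2⟩

lemma mem_crossings_of_sub_mem_halfOpen {x y : ℝ} (hx : x ∈ Ioo a b) (hy : y ∈ Ico a' b')
    (hl : l ∈ L) (h : (x, y) - l ∈ P.halfOpen j) : l ∈ P.crossings (Ioo a b ×ˢ Ioo a' b') j := by
  obtain ⟨⟨hleft, hright⟩, hbottom, htop⟩ := h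
  simp only [Prod.fst_sub, Prod.snd_sub] at hleft hright hbottom htop
  obtain ⟨x', hxx', hx'⟩ := exists_between (lt_min hx.2 (sub_lt_iff_lt_add.1 hright))
  obtain ⟨y', hyy', hy'⟩ := exists_between (lt_min hy.2 (sub_lt_iff_lt_add.1 htop))
  rw [lt_min_iff] at hx' hy'
  refine mem_crossings.2 ⟨hl, (x', y') - l, ?_, ?_⟩
  · rw [P.interior_rect]
    exact ⟨⟨hleft.trans_lt (sub_lt_sub_right hxx' _), sub_lt_iff_lt_add.2 hx'.2⟩,
      hbottom.trans_lt (sub_lt_sub_right hyy' _), sub_lt_iff_lt_add.2 hy'.2⟩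
  · rw [sub_add_cancel]
    exact ⟨⟨hx.1.trans hxx', hx'.1⟩, hy.1.trans_lt hyy', hy'.1⟩

-- A vertical line through the box is cut into pieces by the rectangles that it crosses.
lemma IsMarkovBox.sub_eq_sum_ncard_crossings_mul_height (h : P.IsMarkovBox a b a' b')
    (hab : a < b) (hab' : a' ≤ b') :
    b' - a' = ∑ j, (P.crossings (Ioo a b ×ˢ Ioo a' b') j).ncard * P.height j := by
  obtain ⟨x, hx⟩ := nonempty_Ioo.2 hab
  refine sub_eq_sum_natCard_mul_of_Ico_eq_iUnion P.height_pos
    (X := fun j => P.crossings (Ioo a b ×ˢ Ioo a' b') j)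
    (c := fun s => P.bottom s.1 + s.2.1.2) (d := fun s => P.top s.1 + s.2.1.2)
    (fun s => by rw [add_sub_add_right_eq_sub, P.top_sub_bottom]) ?_ hab' ?_
  · rintro ⟨j, l, hl⟩ ⟨j', l', hl'⟩ hne
    refine disjoint_left.2 fun y hy hy' => hne ?_
    obtain ⟨rfl, rfl⟩ := P.halfOpen_unique hl.1 hl'.1 (h.sub_mem_halfOpen hx hl hy)
      (h.sub_mem_halfOpen hx hl' hy')
    rfl
  · refine Subset.antisymm (fun y hy => ?_) (iUnion_subset fun s => ?_)
    · obtain ⟨j, l, hl, hyl⟩ := P.exists_halfOpen (x, y)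
      exact mem_iUnion.2 ⟨⟨j, l, mem_crossings_of_sub_mem_halfOpen hx hy hl hyl⟩,
        le_sub_iff_add_le.1 hyl.2.1, sub_lt_iff_lt_add.1 hyl.2.2⟩
    · obtain ⟨-, -, hbottom, htop⟩ := h.bounds_of_mem_crossings s.2.2
      exact Ico_subset_Ico hbottom htop

end BiPartition

namespace HyperbolicToralAut

variable {L : Submodule ℤ Plane} (D : HyperbolicToralAut L)

lemma torusMap_injective : Function.Injective D.torusMap := by
  refine L.mkQ_surjective.forall₂.2 fun z w h => ?_
  rwa [torusMap_mkQ, torusMap_mkQ, mkQ_eq_mkQ_iff, ← map_sub, D.planeMap_mem_iff,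
    ← mkQ_eq_mkQ_iff] at h

variable {D} {P Q : BiPartition L}

lemma IsBerg.exists_isMarkovBox (hP : D.IsBerg P) (i : Fin 2) :
    ∃ a b a' b', a < b ∧ a' < b' ∧ b' - a' = |D.lam| * P.height i ∧
      D.planeMap '' interior (P.rect i) = Ioo a b ×ˢ Ioo a' b' ∧ P.IsMarkovBox a b a' b' := by
  obtain ⟨a, b, hab, -, -, hx⟩ := exists_image_mul_Ioo_eq D.mu_ne_zero (P.left_lt_right i)
  obtain ⟨a', b', hab', hlen, hends, hy⟩ :=
    exists_image_mul_Ioo_eq D.lam_ne_zero (P.bottom_lt_top i)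
  have himage : D.planeMap '' interior (P.rect i) = Ioo a b ×ˢ Ioo a' b' := by
    rw [P.interior_rect, ← hx, ← hy]
    exact image_diagMap_prod _ _
  refine ⟨a, b, a', b', hab, hab', by rw [hlen, P.top_sub_bottom], himage, fun z hz hmem => ?_,
    fun x hxab y hyab => ?_⟩
  · obtain ⟨w, hw, rfl⟩ := himage.ge hz
    obtain ⟨t, ht, htw⟩ := hP.2 hmem
    rw [D.torusMap_injective (htw.trans (D.torusMap_mkQ w).symm)] at ht
    exact P.mkQ_notMem_verticalSpine hw ht
  · obtain ⟨s, hs, rfl⟩ := hx.ge hxab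
    rw [hends, ← image_pair (fun t => D.lam * t)] at hyab
    obtain ⟨t, ht, rfl⟩ := hyab
    have hst : L.mkQ (s, t) ∈ P.horizontalSpine :=
      mem_image_of_mem _ (mem_iUnion.2 ⟨i, Ioo_subset_Icc_self hs, ht⟩)
    exact hP.1 ⟨_, hst, rfl⟩

theorem IsBerg.abs_lam_mul_height (hP : D.IsBerg P) (i : Fin 2) : |D.lam| * P.height i =
    ∑ j, (P.crossings (D.planeMap '' interior (P.rect i)) j).ncard * P.height j := by
  obtain ⟨a, b, a', b', hab, hab', hlen, himage, hbox⟩ := hP.exists_isMarkovBox i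
  rw [himage, ← hlen]
  exact hbox.sub_eq_sum_ncard_crossings_mul_height hab hab'.le

lemma abs_lam_ne_natCast (hL : AxisFree L) {b : Plane × Plane} (hb : b ∈ biFan L) (n : ℕ) :
    |D.lam| ≠ n := by
  intro h
  obtain ⟨k, hk⟩ : ∃ k : ℤ, D.lam = k := by
    obtain h | h := abs_eq_abs.1 (h.trans (Nat.abs_cast n).symm)
    · exact ⟨n, by exact_mod_cast h⟩
    · exact ⟨-n, by exact_mod_cast h⟩
  have he := fst_mem_of_mem_biFan hb
  have hzero := hL.eq_zero_of_snd _ (L.sub_mem (D.planeMap_mem_iff.2 he) (L.smul_mem k he)) (by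
    simp [planeMap_apply, ← Int.cast_smul_eq_zsmul ℝ, hk])
  exact D.planeMap_ne_zsmul hb.1.ne' hb.2.1.ne' k (sub_eq_zero.1 hzero)

lemma fst_eq_div_mul_of_snd_eq_mul (D : HyperbolicToralAut L) (hL : AxisFree L)
    {b : Plane × Plane} (hb : b ∈ biFan L) {β : ℝ} {z w : Plane} (hz : z ∈ L) (hw : w ∈ L)
    (hz2 : z.2 = β * b.1.2) (hw2 : w.2 = β * b.2.2) : w.1 = z.1 / b.1.1 * b.2.1 := by
  obtain ⟨m, n, hn, hmu, hlam⟩ := D.exists_coord_planeMap_fst_eq hb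
  have hmem := L.sub_mem (D.planeMap_mem_iff.2 hz) (L.add_mem (L.smul_mem m hz) (L.smul_mem n hw))
  have hzero := congrArg Prod.fst (hL.eq_zero_of_snd _ hmem (by
    simp only [planeMap_apply, ← Int.cast_smul_eq_zsmul ℝ, Prod.snd_sub, Prod.snd_add,
      Prod.smul_snd, smul_eq_mul, hz2, hw2]
    linear_combination β * hlam))
  simp only [planeMap_apply, ← Int.cast_smul_eq_zsmul ℝ, Prod.fst_sub, Prod.fst_add,
    Prod.smul_fst, smul_eq_mul, Prod.fst_zero, sub_eq_zero] at hzero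
  exact eq_div_mul_of_eigen_relation hn hb.1.ne' hmu hzero

lemma diagRel_of_height_eq_mul (D : HyperbolicToralAut L) (hL : AxisFree L) {β : ℝ} (hβ : 0 < β)
    (ρ : Equiv.Perm (Fin 2)) (h : ∀ i, Q.height (ρ i) = β * P.height i) :
    DiagRel P.basis Q.basis := by
  have hρ : ρ = 1 ∨ ρ = Equiv.swap 0 1 := by
    clear h
    decide +revert
  have he := fst_mem_of_mem_biFan Q.basis_mem
  have hf := snd_mem_of_mem_biFan Q.basis_mem
  obtain rfl | rfl := hρ
  · refine ⟨Q.v / P.v, β, div_pos Q.v_pos P.v_pos, hβ, Or.inl ?_⟩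
    have hfst := D.fst_eq_div_mul_of_snd_eq_mul hL P.basis_mem he hf (h 0) (h 1)
    exact Prod.ext (Prod.ext (div_mul_cancel₀ _ P.v_pos.ne').symm (h 0)) (Prod.ext hfst (h 1))
  · refine ⟨Q.u / P.v, β, div_pos Q.u_pos P.v_pos, hβ, Or.inr ?_⟩
    have hfst := D.fst_eq_div_mul_of_snd_eq_mul hL P.basis_mem hf he (h 0) (h 1)
    refine Prod.ext (Prod.ext (hfst.trans ?_) ((h 1).trans ?_)) (Prod.ext ?_ ((h 0).trans ?_)) <;>
      simp [BiPartition.basis, diagPair, mirror, diagMap_apply]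
    · ring
    · field_simp [P.v_pos.ne']

theorem diagRel_of_sameConnectivity (hL : AxisFree L) (hP : D.IsBerg P) (hQ : D.IsBerg Q)
    (h : D.SameConnectivity P Q) : DiagRel P.basis Q.basis := by
  obtain ⟨σ, τ, h⟩ := h
  have hentry (i j : Fin 2) :
      (Q.crossings (D.planeMap '' interior (Q.rect (τ i))) (τ j)).ncard =
        (P.crossings (D.planeMap '' interior (P.rect (σ i))) (σ j)).ncard :=
    congrFun (congrFun h.symm i) j
  have hPeigen := hP.abs_lam_mul_height (σ 0)
  have hQeigen := hQ.abs_lam_mul_height (τ 0)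
  rw [← Equiv.sum_comp σ, Fin.sum_univ_two] at hPeigen
  rw [← Equiv.sum_comp τ, Fin.sum_univ_two, hentry, hentry] at hQeigen
  have hproportional : P.height (σ 0) * Q.height (τ 1) = Q.height (τ 0) * P.height (σ 1) := by
    apply mul_left_cancel₀ (sub_ne_zero.2 (D.abs_lam_ne_natCast hL P.basis_mem
      (P.crossings (D.planeMap '' interior (P.rect (σ 0))) (σ 0)).ncard))
    linear_combination Q.height (τ 1) * hPeigen - P.height (σ 1) * hQeigen
  have hpos := P.height_pos (σ 0)
  refine D.diagRel_of_height_eq_mul hL (div_pos (Q.height_pos (τ 0)) hpos) (σ.symm.trans τ)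
    (σ.surjective.forall.2 fun i => ?_)
  rw [Equiv.trans_apply, Equiv.symm_apply_apply, div_mul_eq_mul_div, eq_div_iff hpos.ne', mul_comm]
  revert i
  exact Fin.forall_fin_two.2 ⟨mul_comm _ _, hproportional⟩

end HyperbolicToralAut

end

theorem mainTheorem4_general (L : Submodule ℤ Plane) [DiscreteTopology L] [IsZLattice ℝ L]
    (D : HyperbolicToralAut L) :
    (∀ P Q : BiPartition L, D.IsBerg P → D.IsBerg Q → D.SameConnectivity P Q →
      ∃ t : Plane, D.IsBerg (P.translate t) ∧ D.Equivalent (P.translate t) Q) ∧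
    (biFan L).Nonempty ∧
    ∀ b ∈ biFan L, ∃ N : ℕ, IsBasicSemiPeriodOrPeriod (cuttingSeq b) N ∧
      ∃ S : Fin N → BiPartition L, (∀ i, D.IsBerg (S i)) ∧
        ∀ Q : BiPartition L, ∃! i, D.SameShape (S i) Q := by
  have hL := D.axisFree
  refine ⟨fun P Q hP hQ h => ?_, biFan_nonempty D, fun b hb => ?_⟩
  · obtain ⟨t, hequiv, hberg⟩ := D.exists_equivalent_of_diagRel
      (HyperbolicToralAut.diagRel_of_sameConnectivity hL hP hQ h)
    exact ⟨t, hberg hQ, hequiv⟩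
  · obtain ⟨N, hN⟩ := exists_isBasicSemiPeriodOrPeriod D hL hb
    choose S hbasis hberg using
      fun i : Fin N => D.exists_isBerg (cutBasis_mem_biFan hL hb (i : ℕ))
    refine ⟨N, hN, S, hberg, fun Q => ?_⟩
    obtain ⟨n, hn⟩ := exists_eq_cutBasis hL hb Q.basis_mem
    simp only [D.sameShape_iff_diagRel, hbasis, hn, diagRel_cutBasis_iff D hL hb]
    exact hN.existsUnique_sub_mem_shiftGroup n

theorem mainTheorem4 (L : Submodule ℤ Plane) [DiscreteTopology L] [IsZLattice ℝ L]
    (D : HyperbolicToralAut L) :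
    (∀ P Q : BiPartition L, D.IsBerg P → D.IsBerg Q → D.SameConnectivity P Q →
      ∃ t : Plane, D.IsBerg (P.translate t) ∧ D.Equivalent (P.translate t) Q) ∧
    (biFan L).Nonempty ∧
    ∀ b ∈ biFan L, ∃ N : ℕ, IsBasicSemiPeriodOrPeriod (cuttingSeq b) N ∧
      ∃ S : Fin N → BiPartition L, (∀ i, D.IsBerg (S i)) ∧
        ∀ Q : BiPartition L, D.IsBerg Q → ∃! i, D.SameShape (S i) Q := by
  obtain ⟨hsame, hnonempty, hcount⟩ := mainTheorem4_general L D
  refine ⟨hsame, hnonempty, fun b hb => ?_⟩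
  obtain ⟨N, hN, S, hS, hQ⟩ := hcount b hb
  exact ⟨N, hN, S, hS, fun Q _ => hQ Q⟩
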